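/- **Theorem 4.5.** Let $m\ge 1$ and let $M\subset\mathbb R^n$ be a simply connected finite-cell PL $m$-manifold, with or without boundary: $M$ is a finite union of convex polytopes (cells), and every point of $M$ has a neighbourhood in $M$ that is piecewise linearly homeomorphic to the closed cube $[0,1]^m$. (In particular $M$ may be closed, i.e. have empty boundary.) Let $B$ be a closed (compact, without boundary) connected PL $(m-1)$-manifold contained in the interior $M\setminus\partial M$; in particular, $B$ may be any closed simply connected PL $(m-1)$-manifold there. Then $B$ separates $M$ into two components: $M\setminus B$ has exactly two connected components. -/

import Mathlib

open Set Topology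

/-- A convex cell (compact convex polytope): the convex hull of a finite set of points. -/
def IsConvexCell {E : Type*} [AddCommGroup E] [Module ℝ E] (C : Set E) : Prop :=
  ∃ s : Set E, s.Finite ∧ C = convexHull ℝ s

/-- `𝒞` is a decomposition of `P` into finitely many convex cells. The cells may overlap in an
arbitrary way, so every finite simplicial, cubical or polytopal complex with underlying set `P`
is an instance. -/
def IsFiniteCellCover {E : Type*} [AddCommGroup E] [Module ℝ E]
    (𝒞 : Set (Set E)) (P : Set E) : Prop :=
  𝒞.Finite ∧ (∀ C ∈ 𝒞, IsConvexCell C) ∧ ⋃₀ 𝒞 = P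

/-- A compact polyhedron: a union of finitely many convex cells. -/
def IsCompactPolyhedron {E : Type*} [AddCommGroup E] [Module ℝ E] (P : Set E) : Prop :=
  ∃ 𝒞 : Set (Set E), IsFiniteCellCover 𝒞 P

/-- `f` is piecewise linear on the compact polyhedron `P`: there are finitely many convex cells
with union `P` such that `f` agrees with an affine map on each of them. (Such an `f` is
continuous on `P`, because the cells are closed.) -/
def IsPLOn {E F : Type*} [AddCommGroup E] [Module ℝ E] [AddCommGroup F] [Module ℝ F]
    (f : E → F) (P : Set E) : Prop :=
  ∃ 𝒞 : Set (Set E), IsFiniteCellCover 𝒞 P ∧ ∀ C ∈ 𝒞, ∃ a : E →ᵃ[ℝ] F, EqOn f a C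

/-- `f` restricts to a piecewise linear homeomorphism from `P` onto `Q`, with inverse `g`. -/
def IsPLHomeo {E F : Type*} [AddCommGroup E] [Module ℝ E] [AddCommGroup F] [Module ℝ F]
    (f : E → F) (g : F → E) (P : Set E) (Q : Set F) : Prop :=
  IsPLOn f P ∧ IsPLOn g Q ∧ MapsTo f P Q ∧ MapsTo g Q P ∧ InvOn g f P Q

/-- The standard `m`-dimensional cube `[0, 1] ^ m`. -/
def stdCube (m : ℕ) : Set (Fin m → ℝ) := Icc 0 1

/-- `f`, with inverse `g`, is a piecewise linear chart of `P` around `x`: it is defined on a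
neighbourhood `N` of `x` in `P` and maps `N` onto the closed `m`-cube. -/
def IsPLChartAt {E : Type*} [AddCommGroup E] [Module ℝ E] [TopologicalSpace E] (m : ℕ)
    (P : Set E) (x : E) (N : Set E) (f : E → Fin m → ℝ) (g : (Fin m → ℝ) → E) : Prop :=
  N ⊆ P ∧ N ∈ 𝓝[P] x ∧ IsPLHomeo f g N (stdCube m)

/-- A finite-cell PL `m`-manifold, with or without boundary: a compact polyhedron in which every
point has a neighbourhood that is PL homeomorphic to the closed `m`-cube. -/
def IsPLManifold {E : Type*} [AddCommGroup E] [Module ℝ E] [TopologicalSpace E] (m : ℕ)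
    (P : Set E) : Prop :=
  IsCompactPolyhedron P ∧ ∀ x ∈ P, ∃ N f g, IsPLChartAt m P x N f g

/-- The manifold interior of `P` in dimension `m`: the points that some chart sends to an interior
point of the cube. -/
def plInterior {E : Type*} [AddCommGroup E] [Module ℝ E] [TopologicalSpace E] (m : ℕ)
    (P : Set E) : Set E :=
  {x | x ∈ P ∧ ∃ N f g, IsPLChartAt m P x N f g ∧ f x ∈ interior (stdCube m)}

/-- A closed PL `m`-manifold: compact and without boundary. -/
def IsClosedPLManifold {E : Type*} [AddCommGroup E] [Module ℝ E] [TopologicalSpace E] (m : ℕ)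
    (P : Set E) : Prop :=
  IsPLManifold m P ∧ P ⊆ plInterior m P

/-! ### Local separators of a closed set, and how they glue -/

section Separator

open Filter

variable {X : Type*} [TopologicalSpace X]

/-! Local flatness of `B` is never used. It suffices that `B` cuts `M` locally in two away from a
set of codimension three. Read in charts, the inclusion of `B` in `M` is a piecewise affine
embedding. Off finitely many codimension-two intersections of hyperplanes it is affine on either
side of a single hyperplane, so its image is locally a hyperplane, possibly bent along an edge,
which visibly cuts small balls into two connected sides. Hence the points where `B` is not two-sided
(`badSet`) have codimension two in `B` and three in `M` (`exists_chart_isThin_badSet`); for `m ≤ 2`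
there are none.

A separator is a two-valued function that is locally constant off `B` and takes both values near
every point of `B`. At a two-sided point the indicator of one side is a local separator, and any two
differ by a constant. The difference stays constant around bad points too, because a set of
codimension two does not disconnect a ball. Local separators and these constants therefore define a
double covering. Over a simply connected space it has a section, which glues them
(`exists_glued_function`). Near a bad point a separator comes from the same gluing inside a ball:
seen from a generic point, the shadow of the bad set has codimension two, its complement is
star-shaped, and the separator found there extends over the shadow
(`exists_sepAt_of_simplyConnected`).

The global separator gives at least two components. Every component of the complement adheres to
some two-sided point, hence to all of them, since they form a connected set. Two components with the
same value then share a side and coincide (`connectedComponentIn_eq_of_separator`). -/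

theorem Bool.xor_chain (a b c : Bool) : (a ^^ c) = ((a ^^ b) ^^ (b ^^ c)) := by
  revert a b c; decide

theorem Bool.eq_of_xor_eq (a b c d : Bool) (h : (a ^^ b) = (c ^^ d)) (h' : b = d) : a = c := by
  revert a b c d; decide

/-- Off `B` and near `x`, the functions `f` and `g` differ by a constant. -/
def GermCompat (B : Set X) (x : X) (f g : X → Bool) : Prop :=
  ∃ c, ∀ᶠ y in 𝓝[Bᶜ] x, (f y ^^ g y) = c

/-- `f` is a local separator of `B` at `x`: it is locally constant at points off `B` and takes both
values arbitrarily close to points of `B`. -/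
def SepAt (B : Set X) (f : X → Bool) (x : X) : Prop :=
  (x ∉ B → ∀ᶠ y in 𝓝 x, f y = f x) ∧ (x ∈ B → ∀ c, ∃ᶠ y in 𝓝[Bᶜ] x, f y = c)

/-- Small neighbourhoods of `b` are cut by `B` into two connected pieces, both of which accumulate
at every nearby point of `B`. -/
def TwoSidedAt (B : Set X) (b : X) : Prop :=
  ∀ W ∈ 𝓝 b, ∃ U U₁ U₂ : Set X, U ⊆ W ∧ IsOpen U ∧ b ∈ U ∧ IsOpen U₁ ∧ IsOpen U₂ ∧
    IsPreconnected U₁ ∧ IsPreconnected U₂ ∧ Disjoint U₁ U₂ ∧ U \ B = U₁ ∪ U₂ ∧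
    U ∩ B ⊆ closure U₁ ∧ U ∩ B ⊆ closure U₂

variable {B : Set X} {f g : X → Bool} {x : X}

theorem SepAt.of_germCompat (hB : IsClosed B) (H : GermCompat B x f g) (hg : SepAt B g x) :
    SepAt B f x := by
  obtain ⟨c, hc⟩ := H
  refine ⟨fun hx => ?_, fun hx d => ?_⟩
  · rw [hB.isOpen_compl.nhdsWithin_eq hx] at hc
    have h0 := hc.self_of_nhds
    filter_upwards [hc, hg.1 hx] with y h1 h2
    exact Bool.eq_of_xor_eq _ _ _ _ (h1.trans h0.symm) h2
  · refine ((hg.2 hx (c ^^ d)).and_eventually hc).mono fun y hy => ?_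
    exact Bool.eq_of_xor_eq _ _ _ _ (hy.2.trans (by cases c <;> cases d <;> rfl : c = (d ^^ (c ^^ d)))) hy.1

theorem nhdsWithin_compl_neBot (hd : Dense Bᶜ) (x : X) : (𝓝[Bᶜ] x).NeBot :=
  mem_closure_iff_nhdsWithin_neBot.1 (hd x)

/-- Density of the complement makes the constant at each point unique. The constant at `y` also
serves nearby points, so it is a locally constant function of the point. -/
theorem IsPreconnected.exists_common_germ (hd : Dense Bᶜ) {V : Set X} (hV : IsPreconnected V)
    (H : ∀ y ∈ V, GermCompat B y f g) :
    ∃ c, ∀ y ∈ V, ∀ᶠ z in 𝓝[Bᶜ] y, (f z ^^ g z) = c := by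
  rcases V.eq_empty_or_nonempty with rfl | ⟨x₀, hx₀⟩
  · exact ⟨true, by simp⟩
  choose! c hc using H
  refine ⟨c x₀, fun y hy => ?_⟩
  have hcont : ContinuousOn c V := by
    intro y hy
    refine (continuousWithinAt_const (b := c y)).congr_of_eventuallyEq ?_ rfl
    have := eventually_nhds_nhdsWithin.2 (hc y hy)
    filter_upwards [mem_nhdsWithin_of_mem_nhds this, self_mem_nhdsWithin] with z hz hzV
    have := nhdsWithin_compl_neBot hd z
    obtain ⟨w, h1, h2⟩ := (hz.and (hc z hzV)).exists
    exact h2.symm.trans h1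
  rw [hV.constant hcont hx₀ hy]
  exact hc y hy

/-- Compatible local two-valued functions on a simply connected space can be glued. -/
theorem exists_glued_function [SimplyConnectedSpace X] [LocallyPathConnectedSpace X]
    (hB : IsClosed B) (hd : Dense Bᶜ) (D : X → Set X) (f : X → X → Bool)
    (hD : ∀ x, IsOpen (D x)) (hxD : ∀ x, x ∈ D x)
    (H : ∀ i j, ∀ x ∈ D i ∩ D j, GermCompat B x (f i) (f j)) :
    ∃ F : X → Bool, ∀ i, ∀ x ∈ D i, GermCompat B x F (f i) := by
  classical
  choose! c hc using H
  have huniq : ∀ i j, ∀ x ∈ D i ∩ D j, ∀ d, (∀ᶠ y in 𝓝[Bᶜ] x, (f i y ^^ f j y) = d) →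
      c i j x = d := by
    intro i j x hx d hd'
    have := nhdsWithin_compl_neBot hd x
    obtain ⟨w, h1, h2⟩ := (hd'.and (hc i j x hx)).exists
    exact h2.symm.trans h1
  have hcont : ∀ i j, ∀ x ∈ D i ∩ D j, ∀ᶠ y in 𝓝 x, c i j y = c i j x := by
    intro i j x hx
    filter_upwards [eventually_nhds_nhdsWithin.2 (hc i j x hx),
      ((hD i).inter (hD j)).mem_nhds hx] with y hy hy'
    exact huniq i j y hy' _ hy
  -- The double covering whose transition functions are the constants `c i j`; the cocycle identity
  -- is that of differences of the `f i`.
  let Z : FiberBundleCore X X Bool :=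
    { baseSet := D
      isOpen_baseSet := hD
      indexAt := id
      mem_baseSet_at := hxD
      coordChange := fun i j x v => c i j x ^^ v
      coordChange_self := by
        intro i x hx v
        rw [huniq i i x ⟨hx, hx⟩ false (Eventually.of_forall fun y => by simp)]
        simp
      continuousOn_coordChange := by
        intro i j
        rintro ⟨x, v⟩ ⟨hx, -⟩
        refine ContinuousAt.continuousWithinAt ?_
        have h1 : ∀ᶠ p : X × Bool in 𝓝 (x, v), (c i j x ^^ v) = (c i j p.1 ^^ p.2) := by
          rw [nhds_prod_eq, nhds_discrete Bool]
          filter_upwards [(hcont i j x hx).prod_mk (mem_pure.2 rfl : {w | w = v} ∈ pure v)]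
          rintro ⟨y, w⟩ ⟨h1, h2⟩
          simp only at h1 h2
          simp [h1, h2]
        exact continuousAt_const.congr h1
      coordChange_comp := by
        intro i j k x hx v
        have : c i k x = (c i j x ^^ c j k x) := by
          refine huniq i k x ⟨hx.1.1, hx.2⟩ _ ?_
          filter_upwards [hc i j x hx.1, hc j k x ⟨hx.1.2, hx.2⟩] with y h1 h2
          rw [← h1, ← h2]
          exact Bool.xor_chain ..
        rw [this, ← Bool.xor_assoc, Bool.xor_comm (c j k x)] }
  have hcov : IsCoveringMap (Bundle.TotalSpace.proj : Bundle.TotalSpace Bool Z.Fiber → X) :=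
    FiberBundle.isCoveringMap
  obtain ⟨x₀⟩ : Nonempty X := inferInstance
  obtain ⟨s, ⟨-, hs⟩, -⟩ := hcov.existsUnique_continuousMap_lifts (ContinuousMap.id X) x₀
    (⟨x₀, true⟩ : Bundle.TotalSpace Bool Z.Fiber) rfl
  have hs' : ∀ x, (s x).proj = x := fun x => congrFun hs x
  let σ : X → X → Bool := fun i x => (Z.localTriv i (s x)).2
  have hσ : ∀ i x, σ i x = (c x i x ^^ σ x x) := by
    intro i x
    have e1 : ∀ j, σ j x = (c (s x).proj j (s x).proj ^^ (s x).2) := fun j => rfl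
    have e0 : c x x x = false :=
      huniq x x x ⟨hxD x, hxD x⟩ false (Eventually.of_forall fun y => by simp)
    rw [e1 i, e1 x, hs' x, e0]
    exact congrArg _ (Bool.false_xor _).symm
  have hσc : ∀ i, ∀ x ∈ D i, ∀ᶠ y in 𝓝 x, σ i y = σ i x := by
    intro i x hx
    have h1 : ContinuousAt (fun y => (Z.localTriv i (s y)).2) x := by
      refine continuousAt_snd.comp ?_
      refine ContinuousAt.comp (f := s) (g := Z.localTriv i) ?_ s.continuous.continuousAt
      refine (Z.localTriv i).continuousOn.continuousAt ?_
      refine (Z.localTriv i).open_source.mem_nhds ?_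
      rw [Bundle.Trivialization.mem_source]
      change (s x).proj ∈ D i
      rw [hs' x]
      exact hx
    have := h1.eventually (p := fun b => b = σ i x) (by rw [nhds_discrete]; exact rfl)
    exact this
  -- Off `B`, changing the chart alters `f i y` and the coordinate `σ i y` of the section by the
  -- same constant. The sum is thus independent of the chart, and the chart indexed by `y` itself is
  -- used.
  refine ⟨fun y => f y y ^^ σ y y, fun i x hx => ⟨σ i x, ?_⟩⟩
  have h1 := (hσc i x hx).and ((hD i).mem_nhds hx)
  filter_upwards [mem_nhdsWithin_of_mem_nhds h1, self_mem_nhdsWithin] with y hy hyB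
  have h2 : (f y y ^^ f i y) = c y i y := by
    have := hc y i y ⟨hxD y, hy.2⟩
    rw [hB.isOpen_compl.nhdsWithin_eq hyB] at this
    exact this.self_of_nhds
  have h3 := hσ i y
  rw [hy.1] at h3
  rw [h3, ← h2]
  generalize f y y = a
  generalize f i y = b
  generalize σ y y = d
  revert a b d
  decide

/-- The points of `B` at which `B` is not locally two-sided. -/
def badSet (B : Set X) : Set X := {b | b ∈ B ∧ ¬ TwoSidedAt B b}

theorem SepAt.continuousOn {U : Set X} (hf : ∀ y ∈ U, SepAt B f y) (hU : U ⊆ Bᶜ) :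
    ContinuousOn f U := fun y hy =>
  (continuousAt_const.congr (((hf y hy).1 (hU hy)).mono fun _ h => h.symm)).continuousWithinAt

theorem GermCompat.of_notMem (hx : x ∉ B) (hf : SepAt B f x)
    (hg : SepAt B g x) : GermCompat B x f g := by
  refine ⟨f x ^^ g x, ?_⟩
  filter_upwards [mem_nhdsWithin_of_mem_nhds (hf.1 hx), mem_nhdsWithin_of_mem_nhds (hg.1 hx)]
    with y h1 h2
  rw [h1, h2]

/-- A separator is constant on each connected side, and both values occur near `x`, so the two
constants are opposite. -/
theorem SepAt.exists_values {U U₁ U₂ : Set X} (hU : IsOpen U) (hxU : x ∈ U)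
    (h₁ : IsPreconnected U₁) (h₂ : IsPreconnected U₂) (hUB : U \ B = U₁ ∪ U₂) (hxB : x ∈ B)
    (hf : ∀ y ∈ U, SepAt B f y) :
    ∃ a, (∀ y ∈ U₁, f y = a) ∧ ∀ y ∈ U₂, f y = !a := by
  have s₁ : U₁ ⊆ U \ B := hUB ▸ subset_union_left
  have s₂ : U₂ ⊆ U \ B := hUB ▸ subset_union_right
  have key : ∀ V : Set X, V ⊆ U \ B → IsPreconnected V → ∃ a, ∀ y ∈ V, f y = a := by
    intro V hV hVp
    rcases V.eq_empty_or_nonempty with rfl | ⟨y₀, hy₀⟩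
    · exact ⟨true, by simp⟩
    · exact ⟨f y₀, fun y hy => hVp.constant
        (SepAt.continuousOn (fun z hz => hf z (hV hz).1) fun z hz => (hV hz).2) hy hy₀⟩
  obtain ⟨a, ha⟩ := key U₁ s₁ h₁
  obtain ⟨b, hb⟩ := key U₂ s₂ h₂
  have hocc : ∀ c, (∃ y ∈ U₁, f y = c) ∨ ∃ y ∈ U₂, f y = c := by
    intro c
    obtain ⟨y, hy, hyU, hyB⟩ := (((hf x hxU).2 hxB c).and_eventually
      ((eventually_nhdsWithin_of_eventually_nhds (hU.eventually_mem hxU)).and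
        eventually_mem_nhdsWithin)).exists
    have : y ∈ U₁ ∪ U₂ := hUB ▸ ⟨hyU, hyB⟩
    exact this.imp (fun h => ⟨y, h, hy⟩) fun h => ⟨y, h, hy⟩
  rcases hocc (!a) with ⟨y, hy, h⟩ | ⟨y, hy, h⟩
  · rw [ha y hy] at h
    simp at h
  · refine ⟨a, ha, fun z hz => ?_⟩
    rw [hb z hz, ← hb y hy, h]

theorem GermCompat.of_twoSidedAt (hx : x ∈ B) (h : TwoSidedAt B x)
    (hf : ∀ᶠ y in 𝓝 x, SepAt B f y) (hg : ∀ᶠ y in 𝓝 x, SepAt B g y) : GermCompat B x f g := by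
  obtain ⟨U, U₁, U₂, hUW, hU, hxU, -, -, p₁, p₂, -, hUB, -, -⟩ := h _ (hf.and hg)
  obtain ⟨a, ha₁, ha₂⟩ := SepAt.exists_values hU hxU p₁ p₂ hUB hx fun y hy => (hUW hy).1
  obtain ⟨b, hb₁, hb₂⟩ := SepAt.exists_values hU hxU p₁ p₂ hUB hx fun y hy => (hUW hy).2
  refine ⟨a ^^ b, ?_⟩
  filter_upwards [mem_nhdsWithin_of_mem_nhds (hU.mem_nhds hxU), self_mem_nhdsWithin] with y hy hyB
  have : y ∈ U₁ ∪ U₂ := hUB ▸ ⟨hy, hyB⟩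
  rcases this with h | h
  · rw [ha₁ y h, hb₁ y h]
  · rw [ha₂ y h, hb₂ y h]
    simp

/-- Two separators near `x` differ by a constant, provided the bad set does not locally disconnect. -/
theorem SepAt.germCompat (hB : IsClosed B) (hd : Dense Bᶜ)
    (hV : ∀ W ∈ 𝓝 x, ∃ V ∈ 𝓝 x, V ⊆ W ∧ IsPreconnected (V \ badSet B))
    (hf : ∀ᶠ y in 𝓝 x, SepAt B f y) (hg : ∀ᶠ y in 𝓝 x, SepAt B g y) : GermCompat B x f g := by
  obtain ⟨V, hVx, hVW, hVp⟩ := hV _ (eventually_eventually_nhds.2 (hf.and hg))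
  obtain ⟨c, hc⟩ := hVp.exists_common_germ (f := f) (g := g) hd (by
    intro y hy
    have h1 := hVW hy.1
    by_cases hyB : y ∈ B
    · refine GermCompat.of_twoSidedAt hyB ?_ (h1.mono fun _ h => h.1) (h1.mono fun _ h => h.2)
      by_contra h
      exact hy.2 ⟨hyB, h⟩
    · exact GermCompat.of_notMem hyB h1.self_of_nhds.1 h1.self_of_nhds.2)
  refine ⟨c, ?_⟩
  filter_upwards [mem_nhdsWithin_of_mem_nhds hVx, self_mem_nhdsWithin] with y hy hyB
  have := hc y ⟨hy, fun h => hyB h.1⟩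
  rw [hB.isOpen_compl.nhdsWithin_eq hyB] at this
  exact this.self_of_nhds

theorem exists_sepAt_of_notMem (hB : IsClosed B) (hx : x ∉ B) :
    ∃ f, ∀ᶠ y in 𝓝 x, SepAt B f y :=
  ⟨fun _ => true, (hB.isOpen_compl.eventually_mem hx).mono fun _ hy =>
    ⟨fun _ => Eventually.of_forall fun _ => rfl, fun h => absurd h hy⟩⟩

theorem TwoSidedAt.exists_sepAt (h : TwoSidedAt B x) : ∃ f, ∀ᶠ y in 𝓝 x, SepAt B f y := by
  classical
  obtain ⟨U, U₁, U₂, -, hU, hxU, o₁, o₂, -, -, hdis, hUB, c₁, c₂⟩ := h univ univ_mem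
  have s₁ : U₁ ⊆ U \ B := hUB ▸ subset_union_left
  have s₂ : U₂ ⊆ U \ B := hUB ▸ subset_union_right
  have v₂ : ∀ y ∈ U₂, decide (y ∈ U₁) = false := fun y hy => by
    simpa using fun h => disjoint_left.1 hdis h hy
  have hfreq : ∀ (V : Set X) (y : X), V ⊆ U \ B → y ∈ closure V → ∃ᶠ z in 𝓝[Bᶜ] y, z ∈ V := by
    intro V y hV hy
    rw [frequently_nhdsWithin_iff]
    exact (mem_closure_iff_frequently.1 hy).mono fun z hz => ⟨hz, (hV hz).2⟩
  refine ⟨fun y => decide (y ∈ U₁), (hU.eventually_mem hxU).mono fun y hy =>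
    ⟨fun hyB => ?_, fun hyB c => ?_⟩⟩
  · have : y ∈ U₁ ∪ U₂ := hUB ▸ ⟨hy, hyB⟩
    rcases this with h | h
    · filter_upwards [o₁.mem_nhds h] with z hz
      simp [hz, h]
    · filter_upwards [o₂.mem_nhds h] with z hz
      rw [v₂ z hz, v₂ y h]
  · cases c
    · exact (hfreq U₂ y s₂ (c₂ ⟨hy, hyB⟩)).mono v₂
    · exact (hfreq U₁ y s₁ (c₁ ⟨hy, hyB⟩)).mono fun z hz => by simpa using hz

theorem exists_sepAt_of_notMem_badSet (hB : IsClosed B) (hx : x ∉ badSet B) :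
    ∃ f, ∀ᶠ y in 𝓝 x, SepAt B f y := by
  by_cases hxB : x ∈ B
  · refine TwoSidedAt.exists_sepAt ?_
    by_contra h
    exact hx ⟨hxB, h⟩
  · exact exists_sepAt_of_notMem hB hxB

theorem decide_eventually_eq_of_eventually {α : Type*} {f : α → Bool} {l : Filter α} [l.NeBot]
    {a : Bool}
    [Decidable (∀ᶠ w in l, f w = true)] (h : ∀ᶠ w in l, f w = a) :
    decide (∀ᶠ w in l, f w = true) = a := by
  cases a
  · simp only [decide_eq_false_iff_not]
    intro h'
    obtain ⟨w, h1, h2⟩ := (h.and h').exists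
    simp [h1] at h2
  · simpa using h

/-- A separator exists near a point having a neighbourhood `D` that contains a simply connected open
set `T` missing the bad set, whose complement in `D` is too small to disconnect locally. -/
theorem exists_sepAt_of_simplyConnected [LocallyPathConnectedSpace X] (hB : IsClosed B)
    (hd : Dense Bᶜ)
    (hV : ∀ x, ∀ W ∈ 𝓝 x, ∃ V ∈ 𝓝 x, V ⊆ W ∧ IsPreconnected (V \ badSet B))
    (hG : B ⊆ closure (B \ badSet B)) {D T : Set X} (hD : IsOpen D) (hxD : x ∈ D)
    (hT : IsOpen T) (hTK : Disjoint T (badSet B)) [SimplyConnectedSpace T]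
    (hDT : D ⊆ closure T)
    (hTV : ∀ y ∈ D, ∀ W ∈ 𝓝 y, ∃ V ∈ 𝓝 y, V ⊆ W ∧ IsPreconnected (V ∩ T)) :
    ∃ f, ∀ᶠ y in 𝓝 x, SepAt B f y := by
  classical
  have hloc : ∀ y, y ∉ badSet B → ∃ f, ∀ᶠ z in 𝓝 y, SepAt B f z := fun y hy =>
    exists_sepAt_of_notMem_badSet hB hy
  choose! p hp using hloc
  have hpT : ∀ y ∈ T, ∀ᶠ z in 𝓝 y, SepAt B (p y) z := fun y hy =>
    hp y (disjoint_left.1 hTK hy)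
  have : LocallyPathConnectedSpace T := hT.locallyPathConnectedSpace
  have hemb : IsOpenEmbedding (Subtype.val : T → X) := hT.isOpenEmbedding_subtypeVal
  obtain ⟨F, hF⟩ := exists_glued_function (X := T) (B := Subtype.val ⁻¹' B)
    (hB.preimage continuous_subtype_val) (hd.preimage hemb.isOpenMap)
    (fun i => Subtype.val ⁻¹' interior {z | SepAt B (p i) z}) (fun i z => p i z)
    (fun i => isOpen_interior.preimage continuous_subtype_val)
    (fun i => mem_interior_iff_mem_nhds.2 (hpT i i.2)) (by
      rintro i j y ⟨h1, h2⟩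
      obtain ⟨c, hc⟩ := SepAt.germCompat hB hd (hV y) (mem_interior_iff_mem_nhds.1 h1)
        (mem_interior_iff_mem_nhds.1 h2)
      refine ⟨c, ?_⟩
      rw [← hemb.map_nhdsWithin_preimage_eq] at hc
      exact hc)
  let χ : X → Bool := fun z => if h : z ∈ T then F ⟨z, h⟩ else false
  have hχ : ∀ y ∈ T, SepAt B χ y := by
    intro y hy
    obtain ⟨c, hc⟩ := hF ⟨y, hy⟩ ⟨y, hy⟩ (mem_interior_iff_mem_nhds.2 (hpT y hy))
    refine SepAt.of_germCompat hB (g := p y) ⟨c, ?_⟩ (hpT y hy).self_of_nhds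
    have hmap := hemb.map_nhdsWithin_preimage_eq Bᶜ ⟨y, hy⟩
    rw [show 𝓝[Bᶜ] y = _ from hmap.symm, eventually_map]
    filter_upwards [hc] with z hz
    simpa [χ] using hz
  -- The limit of `χ` along `T` extends the separator over the part of `D` outside `T`. Near a point
  -- that is not bad, `χ` and a local separator differ on `T` by one constant, so off `B` the limit
  -- exists.
  let G : X → Bool := fun z => decide (∀ᶠ w in 𝓝[T] z, χ w = true)
  have hG' : ∀ y ∈ D \ badSet B, SepAt B G y := by
    rintro y ⟨hyD, hyK⟩
    obtain ⟨V, hVy, hVW, hVp⟩ := hTV y hyD _ (eventually_eventually_nhds.2 (hp y hyK))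
    obtain ⟨c, hc⟩ := hVp.exists_common_germ (f := χ) (g := p y) hd (by
      rintro z ⟨hzV, hzT⟩
      exact SepAt.germCompat hB hd (hV z)
        ((hT.eventually_mem hzT).mono hχ) (hVW hzV))
    refine SepAt.of_germCompat hB (g := p y) ⟨c, ?_⟩ (hp y hyK).self_of_nhds
    filter_upwards [mem_nhdsWithin_of_mem_nhds (eventually_eventually_nhds.2 hVy),
      mem_nhdsWithin_of_mem_nhds (hD.mem_nhds hyD), mem_nhdsWithin_of_mem_nhds (hp y hyK),
      self_mem_nhdsWithin] with z hzV hzD hzS hzB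
    have : (𝓝[T] z).NeBot := mem_closure_iff_nhdsWithin_neBot.1 (hDT hzD)
    have hGz : G z = (c ^^ p y z) := by
      refine decide_eventually_eq_of_eventually ?_
      filter_upwards [mem_nhdsWithin_of_mem_nhds hzV, self_mem_nhdsWithin,
        mem_nhdsWithin_of_mem_nhds (hB.isOpen_compl.mem_nhds hzB),
        mem_nhdsWithin_of_mem_nhds (hzS.1 hzB)] with w hwV hwT hwB hwp
      have := hc w ⟨hwV, hwT⟩
      rw [hB.isOpen_compl.nhdsWithin_eq hwB] at this
      rw [← this.self_of_nhds, ← hwp]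
      simp
    rw [hGz]
    simp
  refine ⟨G, (hD.eventually_mem hxD).mono fun y hyD => ?_⟩
  -- At a bad point only the occurrence of both values has to be checked, and it is inherited from
  -- the two-sided points of `B` that accumulate there.
  by_cases hyK : y ∈ badSet B
  · refine ⟨fun h => absurd hyK.1 h, fun hyB c => ?_⟩
    rw [frequently_nhdsWithin_iff, frequently_iff]
    intro U hU
    obtain ⟨b, hbU, hbB, hbK⟩ := mem_closure_iff.1 (hG hyB) (interior U ∩ D)
      (isOpen_interior.inter hD) ⟨mem_interior_iff_mem_nhds.2 hU, hyD⟩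
    have h1 := (hG' b ⟨hbU.2, hbK⟩).2 hbB c
    rw [frequently_nhdsWithin_iff, frequently_iff] at h1
    obtain ⟨z, hz, hz'⟩ := h1 (isOpen_interior.mem_nhds hbU.1)
    exact ⟨z, interior_subset hz, hz'⟩
  · exact hG' y ⟨hyD, hyK⟩

theorem exists_global_separator [SimplyConnectedSpace X] [LocallyPathConnectedSpace X]
    (hB : IsClosed B) (hd : Dense Bᶜ)
    (hV : ∀ x, ∀ W ∈ 𝓝 x, ∃ V ∈ 𝓝 x, V ⊆ W ∧ IsPreconnected (V \ badSet B))
    (hloc : ∀ x, ∃ f, ∀ᶠ y in 𝓝 x, SepAt B f y) : ∃ f, ∀ x, SepAt B f x := by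
  choose p hp using hloc
  obtain ⟨F, hF⟩ := exists_glued_function hB hd (fun i => interior {z | SepAt B (p i) z}) p
    (fun i => isOpen_interior) (fun i => mem_interior_iff_mem_nhds.2 (hp i)) (by
      rintro i j y ⟨h1, h2⟩
      exact SepAt.germCompat hB hd (hV y) (mem_interior_iff_mem_nhds.1 h1)
        (mem_interior_iff_mem_nhds.1 h2))
  exact ⟨F, fun x => SepAt.of_germCompat hB (hF x x (mem_interior_iff_mem_nhds.2 (hp x)))
    (hp x).self_of_nhds⟩

/-- A dense subset of a preconnected space that is locally preconnected around every point of the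
space is preconnected. -/
theorem Dense.isPreconnected_of_local [PreconnectedSpace X] {G : Set X} (hG : Dense G)
    (h : ∀ x, ∃ V ∈ 𝓝 x, IsPreconnected (V ∩ G)) : IsPreconnected G := by
  refine isPreconnected_of_forall_constant fun f hf x hx y hy => ?_
  choose V hV hVp using h
  have hne : ∀ z, ∃ w, w ∈ V z ∩ G := fun z => by
    obtain ⟨w, hw, hw'⟩ := hG.inter_nhds_nonempty (hV z)
    exact ⟨w, hw', hw⟩
  choose w hw using hne
  have hval : ∀ z, ∀ u ∈ V z ∩ G, f u = f (w z) := fun z u hu =>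
    (hVp z).constant (hf.mono inter_subset_right) hu (hw z)
  have hF : IsLocallyConstant fun z => f (w z) := by
    rw [IsLocallyConstant.iff_eventually_eq]
    intro z
    filter_upwards [eventually_eventually_nhds.2 (hV z)] with u hu
    obtain ⟨t, ht, ht'⟩ := hG.inter_nhds_nonempty (inter_mem hu (hV u))
    rw [← hval u t ⟨ht'.2, ht⟩, ← hval z t ⟨ht'.1, ht⟩]
  rw [hval x x ⟨mem_of_mem_nhds (hV x), hx⟩, hval y y ⟨mem_of_mem_nhds (hV y), hy⟩]
  exact hF.apply_eq_of_isPreconnected isPreconnected_univ (mem_univ x) (mem_univ y)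

/-! ### Counting the components of the complement -/

theorem Nat.card_connectedComponents_eq_two {Z : Type*} [TopologicalSpace Z] {φ : Z → Bool}
    (hφ : Continuous φ) (hs : Function.Surjective φ)
    (h : ∀ y z, φ y = φ z → connectedComponent y = connectedComponent z) :
    Nat.card (ConnectedComponents Z) = 2 := by
  have hb : Function.Bijective hφ.connectedComponentsLift := by
    refine ⟨?_, fun c => ?_⟩
    · intro a b hab
      obtain ⟨y, rfl⟩ := ConnectedComponents.surjective_coe a
      obtain ⟨z, rfl⟩ := ConnectedComponents.surjective_coe b
      rw [ConnectedComponents.coe_eq_coe]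
      exact h y z (by simpa using hab)
    · obtain ⟨z, rfl⟩ := hs c
      exact ⟨z, by simp⟩
  rw [Nat.card_congr (Equiv.ofBijective _ hb)]
  simp

theorem SepAt.eq_of_mem_connectedComponentIn (hf : ∀ x, SepAt B f x) {y z : X}
    (hz : z ∈ connectedComponentIn Bᶜ y) : f z = f y := by
  refine isPreconnected_connectedComponentIn.constant (SepAt.continuousOn (B := B)
    (fun x _ => hf x) (connectedComponentIn_subset _ _)) hz (mem_connectedComponentIn ?_)
  by_contra h
  rw [connectedComponentIn_eq_empty h] at hz
  exact hz

/-- Near a two-sided point, each component of the complement with a prescribed value of the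
separator either contains a common one-sided neighbourhood or stays away. -/
theorem TwoSidedAt.exists_side (hf : ∀ x, SepAt B f x) (hx : x ∈ B) (h : TwoSidedAt B x)
    (c : Bool) : ∃ U S : Set X, IsOpen U ∧ x ∈ U ∧ S.Nonempty ∧ ∀ y ∉ B, f y = c → ∀ b ∈ U ∩ B,
      (b ∈ closure (connectedComponentIn Bᶜ y) ↔ S ⊆ connectedComponentIn Bᶜ y) := by
  obtain ⟨U, U₁, U₂, -, hU, hxU, -, -, p₁, p₂, -, hUB, c₁, c₂⟩ := h univ univ_mem
  obtain ⟨a, ha₁, ha₂⟩ := SepAt.exists_values hU hxU p₁ p₂ hUB hx fun y _ => hf y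
  -- Exchanging the sides negates `a`, so `U₁` can be taken to be the side on which the separator
  -- equals `c`; it is the required `S`.
  wlog hac : a = c generalizing U₁ U₂ a
  · exact this U₂ U₁ p₂ p₁ (hUB.trans (union_comm _ _)) c₂ c₁ (!a) ha₂ (by simpa using ha₁)
      (by cases a <;> cases c <;> simp_all)
  subst hac
  have s₁ : U₁ ⊆ U \ B := hUB ▸ subset_union_left
  refine ⟨U, U₁, hU, hxU, closure_nonempty_iff.1 ⟨x, c₁ ⟨hxU, hx⟩⟩, fun y hy hya b hb => ?_⟩
  refine ⟨fun hbc => ?_, fun hs => closure_mono hs (c₁ hb)⟩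
  obtain ⟨z, hzU, hzC⟩ := mem_closure_iff.1 hbc U hU hb.1
  have hzB : z ∉ B := connectedComponentIn_subset _ _ hzC
  have hza : f z = a := (SepAt.eq_of_mem_connectedComponentIn hf hzC).trans hya
  have hz : z ∈ U₁ ∪ U₂ := hUB ▸ ⟨hzU, hzB⟩
  have hz₁ : z ∈ U₁ := hz.resolve_right fun h2 => by
    have := ha₂ z h2
    simp [hza] at this
  rw [connectedComponentIn_eq hzC]
  exact p₁.subset_connectedComponentIn hz₁ fun w hw => (s₁ hw).2

/-- Otherwise the component, which is open, would be relatively closed in the complement of the bad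
set. That complement is connected, so the component would swallow the two-sided points of `B`. -/
theorem exists_mem_closure_connectedComponentIn [PreconnectedSpace X] [LocallyConnectedSpace X]
    (hB : IsClosed B) (hd : Dense Bᶜ)
    (hV : ∀ x, ∀ W ∈ 𝓝 x, ∃ V ∈ 𝓝 x, V ⊆ W ∧ IsPreconnected (V \ badSet B))
    (hGne : (B \ badSet B).Nonempty) {y : X} (hy : y ∉ B) :
    ∃ b ∈ B \ badSet B, b ∈ closure (connectedComponentIn Bᶜ y) := by
  by_contra! hno
  have hK : IsPreconnected (badSet B)ᶜ := by
    refine (hd.mono (compl_subset_compl.2 fun z hz => hz.1)).isPreconnected_of_local fun x => ?_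
    obtain ⟨V, hVx, -, hVp⟩ := hV x univ univ_mem
    exact ⟨V, hVx, hVp⟩
  have hsub : (badSet B)ᶜ ⊆ connectedComponentIn Bᶜ y := by
    refine hK.subset_of_closure_inter_subset hB.isOpen_compl.connectedComponentIn
      ⟨y, fun h => hy h.1, mem_connectedComponentIn hy⟩ ?_
    rintro z ⟨hzc, hzK⟩
    have hzB : z ∈ Bᶜ := fun h => hno z ⟨h, hzK⟩ hzc
    obtain ⟨w, hw, hw'⟩ := mem_closure_iff.1 hzc _ hB.isOpen_compl.connectedComponentIn
      (mem_connectedComponentIn hzB)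
    rw [connectedComponentIn_eq hw', ← connectedComponentIn_eq hw]
    exact mem_connectedComponentIn hzB
  obtain ⟨b, hb, hbK⟩ := hGne
  exact connectedComponentIn_subset _ _ (hsub hbK) hb

/-- By `TwoSidedAt.exists_side`, adherence of a component to a two-sided point is a locally constant
condition on that point, so every component adheres to all of them. At any one of them, components
with equal value contain the same side. -/
theorem connectedComponentIn_eq_of_separator [PreconnectedSpace X] [LocallyConnectedSpace X]
    (hB : IsClosed B) (hd : Dense Bᶜ)
    (hV : ∀ x, ∀ W ∈ 𝓝 x, ∃ V ∈ 𝓝 x, V ⊆ W ∧ IsPreconnected (V \ badSet B))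
    (hGne : (B \ badSet B).Nonempty) (hGp : IsPreconnected (B \ badSet B))
    (hf : ∀ x, SepAt B f x) {y z : X} (hy : y ∉ B) (hz : z ∉ B) (hyz : f y = f z) :
    connectedComponentIn Bᶜ y = connectedComponentIn Bᶜ z := by
  classical
  have htwo : ∀ b ∈ B \ badSet B, TwoSidedAt B b := fun b hb => by
    by_contra h
    exact hb.2 ⟨hb.1, h⟩
  have hall : ∀ y, y ∉ B → ∀ b ∈ B \ badSet B, b ∈ closure (connectedComponentIn Bᶜ y) := by
    intro y hy b hb
    obtain ⟨b₀, hb₀, hb₀c⟩ := exists_mem_closure_connectedComponentIn hB hd hV hGne hy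
    have hcont : ContinuousOn (fun b => decide (b ∈ closure (connectedComponentIn Bᶜ y)))
        (B \ badSet B) := by
      intro b hb
      obtain ⟨U, S, hU, hbU, -, hS⟩ := (htwo b hb).exists_side hf hb.1 (f y)
      refine (continuousWithinAt_const
        (b := decide (b ∈ closure (connectedComponentIn Bᶜ y)))).congr_of_eventuallyEq ?_ rfl
      filter_upwards [mem_nhdsWithin_of_mem_nhds (hU.mem_nhds hbU), self_mem_nhdsWithin]
        with b' hb' hb''
      rw [decide_eq_decide, hS y hy rfl b' ⟨hb', hb''.1⟩, hS y hy rfl b ⟨hbU, hb.1⟩]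
    have := hGp.constant hcont hb hb₀
    simpa [hb₀c] using this
  obtain ⟨b, hb⟩ := hGne
  obtain ⟨U, S, hU, hbU, ⟨s, hs⟩, hS⟩ := (htwo b hb).exists_side hf hb.1 (f y)
  have h1 := (hS y hy rfl b ⟨hbU, hb.1⟩).1 (hall y hy b hb) hs
  have h2 := (hS z hz hyz.symm b ⟨hbU, hb.1⟩).1 (hall z hz b hb) hs
  rw [connectedComponentIn_eq h1, connectedComponentIn_eq h2]

/-- A separator whose two-sided points form a nonempty connected set leaves exactly two components. -/
theorem card_connectedComponents_of_separator [PreconnectedSpace X] [LocallyConnectedSpace X]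
    (hB : IsClosed B) (hd : Dense Bᶜ)
    (hV : ∀ x, ∀ W ∈ 𝓝 x, ∃ V ∈ 𝓝 x, V ⊆ W ∧ IsPreconnected (V \ badSet B))
    (hGne : (B \ badSet B).Nonempty) (hGp : IsPreconnected (B \ badSet B))
    (hf : ∀ x, SepAt B f x) {Z : Type*} [TopologicalSpace Z] {j : Z → X} (hj : IsEmbedding j)
    (hjr : range j = Bᶜ) : Nat.card (ConnectedComponents Z) = 2 := by
  have hjB : ∀ z, j z ∉ B := fun z => by
    have : j z ∈ Bᶜ := hjr ▸ mem_range_self z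
    exact this
  refine Nat.card_connectedComponents_eq_two (φ := fun z => f (j z)) ?_ ?_ ?_
  · have := SepAt.continuousOn (fun y (_ : y ∈ Bᶜ) => hf y) subset_rfl
    exact this.comp_continuous hj.continuous hjB
  · intro c
    obtain ⟨b, hb, -⟩ := hGne
    obtain ⟨y, hy, hyB⟩ := (((hf b).2 hb c).and_eventually eventually_mem_nhdsWithin).exists
    rw [← hjr] at hyB
    obtain ⟨z, rfl⟩ := hyB
    exact ⟨z, hy⟩
  · intro y z hyz
    have h1 := connectedComponentIn_eq_of_separator hB hd hV hGne hGp hf (hjB y) (hjB z) hyz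
    have hpre : IsPreconnected (j ⁻¹' connectedComponentIn Bᶜ (j y)) := by
      rw [← hj.isInducing.isPreconnected_image, image_preimage_eq_of_subset]
      · exact isPreconnected_connectedComponentIn
      · rw [hjr]
        exact connectedComponentIn_subset _ _
    refine connectedComponent_eq (hpre.subset_connectedComponent ?_ ?_)
    · exact mem_connectedComponentIn (hjB y)
    · rw [mem_preimage, h1]
      exact mem_connectedComponentIn (hjB z)

end Separator

/-! ### Thin sets, their shadows and connectivity -/

section Thin

open Module

variable {E : Type*} [NormedAddCommGroup E] [NormedSpace ℝ E]

/-- `S` is contained in finitely many affine subspaces of codimension at least `c`. -/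
def IsThin (c : ℕ) (S : Set E) : Prop :=
  ∃ 𝓐 : Set (AffineSubspace ℝ E), 𝓐.Finite ∧
    (∀ A ∈ 𝓐, finrank ℝ A.direction + c ≤ finrank ℝ E) ∧ S ⊆ ⋃ A ∈ 𝓐, (A : Set E)

variable {c : ℕ} {S S' : Set E}

theorem IsThin.mono (h : IsThin c S) (hS : S' ⊆ S) : IsThin c S' := by
  obtain ⟨𝓐, h1, h2, h3⟩ := h
  exact ⟨𝓐, h1, h2, hS.trans h3⟩

theorem IsThin.of_le {c' : ℕ} (h : IsThin c S) (hc : c' ≤ c) : IsThin c' S := by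
  obtain ⟨𝓐, h1, h2, h3⟩ := h
  exact ⟨𝓐, h1, fun A hA => by have := h2 A hA; omega, h3⟩

theorem isThin_biUnion {ι : Type*} {s : Set ι} (hs : s.Finite) {T : ι → Set E}
    (h : ∀ i ∈ s, IsThin c (T i)) : IsThin c (⋃ i ∈ s, T i) := by
  choose! 𝓐 h1 h2 h3 using h
  refine ⟨⋃ i ∈ s, 𝓐 i, hs.biUnion h1, ?_, ?_⟩
  · intro A hA
    obtain ⟨i, hi, hA⟩ := mem_iUnion₂.1 hA
    exact h2 i hi A hA
  · intro x hx
    obtain ⟨i, hi, hx⟩ := mem_iUnion₂.1 hx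
    obtain ⟨A, hA, hx⟩ := mem_iUnion₂.1 (h3 i hi hx)
    exact mem_iUnion₂.2 ⟨A, mem_iUnion₂.2 ⟨i, hi, hA⟩, hx⟩

theorem IsThin.union (h : IsThin c S) (h' : IsThin c S') : IsThin c (S ∪ S') := by
  rw [union_eq_iUnion]
  have := isThin_biUnion (s := (univ : Set Bool)) (c := c) (T := fun b => cond b S S')
    finite_univ (by rintro (_ | _) - <;> simpa)
  simpa using this

theorem isThin_affineSubspace {A : AffineSubspace ℝ E}
    (hA : finrank ℝ A.direction + c ≤ finrank ℝ E) : IsThin c (A : Set E) :=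
  ⟨{A}, finite_singleton A, by simpa using hA, by simp⟩

/-- Affine maps do not raise dimension. This turns codimension two in the parameter space of `B`
into codimension three in `M`. -/
theorem IsThin.image {F : Type*} [NormedAddCommGroup F] [NormedSpace ℝ F] [FiniteDimensional ℝ E]
    (h : IsThin c S) (α : E →ᵃ[ℝ] F) {d : ℕ} (hd : finrank ℝ F = finrank ℝ E + d) :
    IsThin (c + d) (α '' S) := by
  obtain ⟨𝓐, h1, h2, h3⟩ := h
  refine ⟨AffineSubspace.map α '' 𝓐, h1.image _, ?_, ?_⟩
  · rintro _ ⟨A, hA, rfl⟩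
    have e1 := h2 A hA
    have e2 := Submodule.finrank_map_le α.linear A.direction
    rw [AffineSubspace.map_direction]
    omega
  · rintro _ ⟨x, hx, rfl⟩
    obtain ⟨A, hA, hx⟩ := mem_iUnion₂.1 (h3 hx)
    exact mem_iUnion₂.2 ⟨_, mem_image_of_mem _ hA, mem_image_of_mem α hx⟩

variable [FiniteDimensional ℝ E]

/-- Proper affine subspaces are null for Haar measure, and a conull set is dense. -/
theorem IsThin.dense_compl (h : IsThin 1 S) : Dense Sᶜ := by
  borelize E
  obtain ⟨𝓐, h1, h2, h3⟩ := h
  let b := Module.finBasis ℝ E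
  have h0 : b.addHaar S = 0 := by
    refine MeasureTheory.measure_mono_null h3 ?_
    rw [MeasureTheory.measure_biUnion_null_iff h1.countable]
    intro A hA
    refine MeasureTheory.Measure.addHaar_affineSubspace _ A ?_
    rintro rfl
    have := h2 _ hA
    rw [AffineSubspace.direction_top, finrank_top] at this
    omega
  refine MeasureTheory.Measure.dense_of_ae (μ := b.addHaar) ?_
  simpa [MeasureTheory.ae_iff] using h0

/-- The union of all lines through `z` that meet a thin set is thin, of codimension one less. -/
theorem IsThin.shadow (h : IsThin (c + 1) S) : ∃ C, IsClosed C ∧ S ⊆ C ∧ IsThin (c + 1) C ∧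
    ∀ z ∉ C, IsThin c {p | ∃ s : ℝ, AffineMap.lineMap z p s ∈ C} := by
  obtain ⟨𝓐, h1, h2, h3⟩ := h
  refine ⟨_, h1.isClosed_biUnion fun A _ => A.closed_of_finiteDimensional, h3,
    ⟨𝓐, h1, h2, subset_rfl⟩, fun z hz => ?_⟩
  refine ⟨(fun A : AffineSubspace ℝ E => affineSpan ℝ (insert z (A : Set E))) '' 𝓐, h1.image _,
    ?_, ?_⟩
  · rintro _ ⟨A, hA, rfl⟩
    have e1 := h2 A hA
    have e2 := finrank_vectorSpan_insert_le A z
    rw [direction_affineSpan]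
    omega
  · rintro p ⟨s, hs⟩
    obtain ⟨A, hA, hs⟩ := mem_iUnion₂.1 hs
    refine mem_iUnion₂.2 ⟨_, mem_image_of_mem _ hA, ?_⟩
    -- As `z` lies outside `C`, the point on `A` differs from `z`, and `p` is recovered on the line
    -- joining them by rescaling with `s⁻¹`.
    have hs0 : s ≠ 0 := by
      rintro rfl
      rw [AffineMap.lineMap_apply_zero] at hs
      exact hz (mem_iUnion₂.2 ⟨A, hA, hs⟩)
    have hp : AffineMap.lineMap z (AffineMap.lineMap z p s : E) s⁻¹ = p := by
      simp [AffineMap.lineMap_apply, smul_smul, inv_mul_cancel₀ hs0]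
    rw [← hp]
    exact AffineMap.lineMap_mem _ (subset_affineSpan ℝ _ (mem_insert z _))
      (subset_affineSpan ℝ _ (mem_insert_of_mem z hs))

theorem IsOpen.subset_closure_diff_of_isThin {U : Set E} (hU : IsOpen U) (h : IsThin 1 S) :
    U ⊆ closure (U \ S) :=
  h.dense_compl.open_subset_closure_inter hU

/-- The shadows from two given points have codimension one, so a generic third point sees both along
segments that miss a closed thin set `C` containing `S`. Then `U \ S` lies between `U \ C` and its
closure. -/
theorem IsThin.isPreconnected_diff (h : IsThin 2 S) {U : Set E} (hU : IsOpen U)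
    (hUc : Convex ℝ U) : IsPreconnected (U \ S) := by
  obtain ⟨C, hC, hSC, hCt, hsh⟩ := h.shadow (c := 1)
  have hpre : IsPreconnected (U \ C) := by
    refine isPreconnected_of_forall_pair ?_
    rintro p ⟨hpU, hpC⟩ q ⟨hqU, hqC⟩
    obtain ⟨w, hw, hwU⟩ := ((hsh p hpC).union (hsh q hqC)).dense_compl.exists_mem_open hU ⟨p, hpU⟩
    have hseg : ∀ r ∈ U, (∀ s : ℝ, AffineMap.lineMap r w s ∉ C) → segment ℝ r w ⊆ U \ C := by
      intro r hr hrs y hy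
      refine ⟨hUc.segment_subset hr hwU hy, ?_⟩
      rw [segment_eq_image_lineMap] at hy
      obtain ⟨s, -, rfl⟩ := hy
      exact hrs s
    refine ⟨segment ℝ p w ∪ segment ℝ q w, union_subset (hseg p hpU ?_) (hseg q hqU ?_),
      .inl (left_mem_segment ℝ p w), .inr (left_mem_segment ℝ q w),
      IsPreconnected.union w (right_mem_segment ℝ p w) (right_mem_segment ℝ q w)
      (convex_segment p w).isPreconnected (convex_segment q w).isPreconnected⟩
    · exact fun s hs => hw (.inl ⟨s, hs⟩)
    · exact fun s hs => hw (.inr ⟨s, hs⟩)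
  exact hpre.subset_closure (sdiff_subset_sdiff_right hSC)
    (sdiff_subset.trans (hU.subset_closure_diff_of_isThin (hCt.of_le (by norm_num))))

/-- Off the shadow of a set of codimension at least three, seen from a generic point, a convex open
set is star-shaped. -/
theorem IsThin.exists_starConvex (h : IsThin 3 S) {U : Set E} (hU : IsOpen U)
    (hUc : Convex ℝ U) (hUne : U.Nonempty) :
    ∃ T ⊆ U, IsOpen T ∧ Disjoint T S ∧ (∃ z ∈ T, StarConvex ℝ z T) ∧ IsThin 2 (U \ T) := by
  obtain ⟨C, hC, hSC, hCt, hsh⟩ := h.shadow (c := 2)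
  obtain ⟨z, hzC, hzU⟩ := (hCt.of_le (by norm_num : 1 ≤ 3)).dense_compl.exists_mem_open hU hUne
  -- The points hidden from `z` by `C`. Restricting the parameter to the compact unit interval makes
  -- this set closed, and what it leaves of `U` star-shaped around `z`.
  let R : Set E := {p | ∃ s : unitInterval, AffineMap.lineMap z p (s : ℝ) ∈ C}
  have hR : IsClosed R := by
    have : R = Prod.snd '' {q : unitInterval × E | AffineMap.lineMap z q.2 (q.1 : ℝ) ∈ C} := by
      ext p
      simp [R]
    rw [this]
    refine isClosedMap_snd_of_compactSpace _ (hC.preimage ?_)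
    simp only [AffineMap.lineMap_apply]
    fun_prop
  refine ⟨U \ R, sdiff_subset, hU.sdiff hR, ?_, ⟨z, ⟨hzU, ?_⟩, ?_⟩, ?_⟩
  · refine disjoint_left.2 fun p hp hpS => hp.2 ⟨1, ?_⟩
    simpa using hSC hpS
  · rintro ⟨s, hs⟩
    rw [AffineMap.lineMap_same_apply] at hs
    exact hzC hs
  · rintro p ⟨hpU, hpR⟩ a b ha hb hab
    have hab' : a • z + b • p = AffineMap.lineMap z p b := by
      rw [AffineMap.lineMap_apply_module, ← hab]
      simp
    refine ⟨hUc hzU hpU ha hb hab, ?_⟩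
    rintro ⟨s, hs⟩
    rw [hab', AffineMap.lineMap_lineMap_right] at hs
    exact hpR ⟨⟨_, mul_nonneg s.2.1 hb, mul_le_one₀ s.2.2 hb (by linarith)⟩, hs⟩
  · refine (hsh z hzC).mono ?_
    rintro p ⟨hpU, hp⟩
    have : p ∈ R := by
      by_contra h'
      exact hp ⟨hpU, h'⟩
    obtain ⟨s, hs⟩ := this
    exact ⟨s, hs⟩

end Thin

/-! ### Frontiers of polyhedral pieces -/

section Polyhedral

open Module

variable {E : Type*} [NormedAddCommGroup E] [NormedSpace ℝ E]
  {F : Type*} [NormedAddCommGroup F] [NormedSpace ℝ F]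

/-- Positive weights stay nonnegative under a small move towards any affine weights of `p`. -/
theorem exists_pos_add_smul_mem_convexHull {ι : Type*} [Fintype ι] {z : ι → E} {w : ι → ℝ}
    (hw : ∀ i, 0 < w i) (hw1 : ∑ i, w i = 1) {p : E} (hp : p ∈ affineSpan ℝ (range z)) :
    ∃ ε > (0 : ℝ), AffineMap.lineMap (∑ i, w i • z i) p ε ∈ convexHull ℝ (range z) := by
  obtain ⟨v, hv1, rfl⟩ := eq_affineCombination_of_mem_affineSpan_of_fintype hp
  rw [Finset.affineCombination_eq_linear_combination _ _ _ hv1]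
  have hev : ∀ᶠ ε in 𝓝[>] (0 : ℝ), ∀ i, 0 ≤ AffineMap.lineMap (w i) (v i) ε := by
    refine Filter.eventually_all.2 fun i => ?_
    have hc : Filter.Tendsto (fun ε : ℝ => AffineMap.lineMap (w i) (v i) ε) (𝓝 0) (𝓝 (w i)) := by
      have := (AffineMap.lineMap_continuous (R := ℝ) (p := w i) (q := v i)).tendsto 0
      simpa using this
    exact Filter.Eventually.filter_mono nhdsWithin_le_nhds
      ((hc.eventually (lt_mem_nhds (hw i))).mono fun _ h => le_of_lt h)
  obtain ⟨ε, hε, hε0⟩ := (hev.and self_mem_nhdsWithin).exists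
  refine ⟨ε, hε0, ?_⟩
  have : AffineMap.lineMap (∑ i, w i • z i) (∑ i, v i • z i) ε
      = ∑ i, (AffineMap.lineMap (w i) (v i) ε : ℝ) • z i := by
    simp only [AffineMap.lineMap_apply_module, Finset.smul_sum, smul_smul, ← Finset.sum_add_distrib,
      smul_eq_mul, add_smul]
  rw [this]
  refine (convex_convexHull ℝ _).sum_mem (fun i _ => hε i) ?_
    fun i _ => subset_convexHull ℝ _ (mem_range_self i)
  simp only [AffineMap.lineMap_apply_module, smul_eq_mul, Finset.sum_add_distrib,
    ← Finset.mul_sum, hw1, hv1]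
  ring

/-- A point of a convex set from which one can move a little in every direction is interior. -/
theorem Convex.mem_interior_of_forall_lineMap [FiniteDimensional ℝ F] {S : Set F} (hS : Convex ℝ S)
    {q : F} (hq : q ∈ S) (h : ∀ z, ∃ ε > (0 : ℝ), AffineMap.lineMap q z ε ∈ S) : q ∈ interior S := by
  have hspan : affineSpan ℝ S = ⊤ := by
    refine eq_top_iff.2 fun z _ => ?_
    obtain ⟨ε, hε, hz⟩ := h z
    have : AffineMap.lineMap q (AffineMap.lineMap q z ε : F) ε⁻¹ = z := by
      simp [AffineMap.lineMap_apply, smul_smul, inv_mul_cancel₀ hε.ne']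
    rw [← this]
    exact AffineMap.lineMap_mem _ (subset_affineSpan ℝ S hq) (subset_affineSpan ℝ S hz)
  obtain ⟨z₀, hz₀⟩ := hS.interior_nonempty_iff_affineSpan_eq_top.2 hspan
  -- Moving slightly towards the reflection of `z₀` in `q` reaches a point of `S` beyond `q`, so `q`
  -- lies strictly between it and the interior point `z₀`.
  obtain ⟨ε, hε, hz⟩ := h (q + (q - z₀))
  refine hS.openSegment_interior_self_subset_interior hz₀ hz
    ⟨ε / (1 + ε), 1 / (1 + ε), by positivity, by positivity, by field_simp; ring, ?_⟩
  have h1 : (1 + ε) ≠ 0 := by positivity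
  rw [AffineMap.lineMap_apply, vsub_eq_sub, vadd_eq_add]
  have : (1 / (1 + ε)) • (ε • (q + (q - z₀) - q) + q) =
      (1 / (1 + ε)) • (((1 + ε) • q) - ε • z₀) := by
    congr 1
    module
  rw [this, smul_sub, smul_smul, smul_smul, div_mul_cancel₀ _ h1, div_mul_eq_mul_div, one_mul,
    one_smul]
  abel

/-- A point of the preimage maps to a positive combination of some subset of `s`. If the affine span
of that subset pulled back to all of `F`, the point could move in every direction and be interior.
So frontier points lie in proper pullbacks, of which there are finitely many. -/
theorem isThin_frontier_preimage_convexHull [FiniteDimensional ℝ F] (a : F →ᵃ[ℝ] E) {s : Set E}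
    (hs : s.Finite) :
    IsThin 1 (frontier (a ⁻¹' convexHull ℝ s)) := by
  have hcl : IsClosed (a ⁻¹' convexHull ℝ s) :=
    (hs.isClosed_convexHull ℝ).preimage a.continuous_of_finiteDimensional
  have hconv : Convex ℝ (a ⁻¹' convexHull ℝ s) := (convex_convexHull ℝ s).affine_preimage a
  refine ⟨{A ∈ (fun T => (affineSpan ℝ T).comap a) '' 𝒫 s |
    finrank ℝ A.direction + 1 ≤ finrank ℝ F}, ?_, fun A hA => hA.2, ?_⟩
  · exact (hs.finite_subsets.image _).subset fun A hA => hA.1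
  rw [hcl.frontier_eq]
  rintro q ⟨hqS, hqi⟩
  obtain ⟨ι, _, z, w, hzs, -, hw, hw1, hwq⟩ := eq_pos_convex_span_of_mem_convexHull hqS
  have hqA : q ∈ (affineSpan ℝ (range z)).comap a := by
    rw [AffineSubspace.mem_comap, ← hwq]
    exact convexHull_subset_affineSpan _ ((convex_convexHull ℝ _).sum_mem (fun i _ => (hw i).le) hw1
      fun i _ => subset_convexHull ℝ _ (mem_range_self i))
  refine mem_iUnion₂.2 ⟨_, ⟨mem_image_of_mem _ hzs, ?_⟩, hqA⟩
  refine Submodule.finrank_lt fun htop => hqi ?_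
  rw [AffineSubspace.direction_eq_top_iff_of_nonempty ⟨q, hqA⟩] at htop
  refine hconv.mem_interior_of_forall_lineMap hqS fun p => ?_
  have hp : p ∈ (affineSpan ℝ (range z)).comap a := htop ▸ AffineSubspace.mem_top ℝ F p
  obtain ⟨ε, hε, h⟩ := exists_pos_add_smul_mem_convexHull hw hw1 (AffineSubspace.mem_comap.1 hp)
  refine ⟨ε, hε, ?_⟩
  rw [hwq] at h
  rw [mem_preimage, AffineMap.apply_lineMap]
  exact convexHull_mono hzs h

theorem IsThin.exists_hyperplanes {S : Set F} (h : IsThin 1 S) :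
    ∃ 𝓗 : Set ((F →ₗ[ℝ] ℝ) × ℝ), 𝓗.Finite ∧ (∀ H ∈ 𝓗, H.1 ≠ 0) ∧ ∀ x ∈ S, ∃ H ∈ 𝓗, H.1 x = H.2 := by
  obtain ⟨𝓐, h1, h2, h3⟩ := h
  have hA : ∀ A ∈ 𝓐, ∃ H : (F →ₗ[ℝ] ℝ) × ℝ, H.1 ≠ 0 ∧ ∀ x ∈ A, H.1 x = H.2 := by
    intro A hA
    have hlt : A.direction < ⊤ := by
      refine lt_top_iff_ne_top.2 fun h => ?_
      have := h2 A hA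
      rw [h, finrank_top] at this
      omega
    obtain ⟨ℓ, hℓ, hker⟩ := A.direction.exists_le_ker_of_lt_top hlt
    rcases (A : Set F).eq_empty_or_nonempty with he | ⟨p, hp⟩
    · exact ⟨(ℓ, 0), hℓ, fun x hx => absurd hx (by rw [← SetLike.mem_coe, he]; simp)⟩
    · refine ⟨(ℓ, ℓ p), hℓ, fun x hx => ?_⟩
      have := hker (AffineSubspace.vsub_mem_direction hx hp)
      rw [LinearMap.mem_ker, vsub_eq_sub, map_sub, sub_eq_zero] at this
      exact this
  choose! H hH hH' using hA
  refine ⟨H '' 𝓐, h1.image _, ?_, ?_⟩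
  · rintro _ ⟨A, hA, rfl⟩
    exact hH A hA
  · intro x hx
    obtain ⟨A, hA, hx⟩ := mem_iUnion₂.1 (h3 hx)
    exact ⟨_, mem_image_of_mem _ hA, hH' A hA x hx⟩

theorem isThin_inter_hyperplanes [FiniteDimensional ℝ F] {ℓ ℓ' : F →ₗ[ℝ] ℝ} (c c' : ℝ)
    (hne : LinearMap.ker ℓ ≠ LinearMap.ker ℓ') (h : ℓ ≠ 0) (h' : ℓ' ≠ 0) :
    IsThin 2 {x | ℓ x = c ∧ ℓ' x = c'} := by
  rcases ({x | ℓ x = c ∧ ℓ' x = c'} : Set F).eq_empty_or_nonempty with he | ⟨q, hq, hq'⟩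
  · rw [he]
    exact ⟨∅, finite_empty, by simp, by simp⟩
  have hlt : LinearMap.ker ℓ ⊓ LinearMap.ker ℓ' < LinearMap.ker ℓ := by
    refine inf_le_left.lt_of_ne fun heq => hne ?_
    refine Submodule.eq_of_le_of_finrank_eq (inf_eq_left.1 heq) ?_
    have e1 := Module.Dual.finrank_ker_add_one_of_ne_zero h
    have e2 := Module.Dual.finrank_ker_add_one_of_ne_zero h'
    omega
  have e1 := Module.Dual.finrank_ker_add_one_of_ne_zero h
  have e2 := Submodule.finrank_lt_finrank_of_lt hlt
  refine (isThin_affineSubspace (A := AffineSubspace.mk' q (LinearMap.ker ℓ ⊓ LinearMap.ker ℓ'))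
    (c := 2) ?_).mono ?_
  · rw [AffineSubspace.direction_mk']
    omega
  · rintro x ⟨hx, hx'⟩
    rw [SetLike.mem_coe, AffineSubspace.mem_mk', Submodule.mem_inf, LinearMap.mem_ker,
      LinearMap.mem_ker, vsub_eq_sub, map_sub, map_sub, hx, hx', hq, hq']
    simp

end Polyhedral

/-! ### Piecewise affine maps off codimension two -/

section Hinge

open Module

variable {E : Type*} [NormedAddCommGroup E] [NormedSpace ℝ E]
  {F : Type*} [NormedAddCommGroup F] [NormedSpace ℝ F]

theorem IsPreconnected.subset_of_disjoint_frontier {X : Type*} [TopologicalSpace X] {s t : Set X}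
    (hs : IsPreconnected s) (ht : IsClosed t) (hne : (s ∩ t).Nonempty)
    (hd : Disjoint s (frontier t)) : s ⊆ t := by
  refine (hs.subset_of_closure_inter_subset (u := interior t) isOpen_interior ?_ ?_).trans
    interior_subset
  · obtain ⟨x, hxs, hxt⟩ := hne
    refine ⟨x, hxs, ?_⟩
    by_contra h
    exact disjoint_left.1 hd hxs (ht.frontier_eq ▸ ⟨hxt, h⟩)
  · rintro x ⟨hx, hxs⟩
    by_contra h
    exact disjoint_left.1 hd hxs
      (ht.frontier_eq ▸ ⟨closure_minimal interior_subset ht hx, h⟩)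

variable [FiniteDimensional ℝ F]

/-- The open half-ball is connected and misses every frontier, so it lies in a single piece; that
piece is closed and hence contains the flat face as well. -/
theorem exists_piece_of_halfBall {ι : Type*} {S : ι → Set F} (hS : ∀ i, IsClosed (S i))
    {ℓ : F →ₗ[ℝ] ℝ} (hℓ : ℓ ≠ 0) {q : F} {r : ℝ} (hr : 0 < r)
    (hcov : Metric.ball q r ⊆ ⋃ i, S i)
    (hfr : ∀ i, ∀ x ∈ Metric.ball q r ∩ frontier (S i), ℓ (x - q) = 0) :
    ∃ i, ∀ x ∈ Metric.ball q r, 0 ≤ ℓ (x - q) → x ∈ S i := by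
  have hc : Continuous ℓ := ℓ.continuous_of_finiteDimensional
  obtain ⟨u, hu⟩ : ∃ u, ℓ u = 1 := LinearMap.surjective hℓ 1
  let V : Set F := Metric.ball q r ∩ {x | 0 < ℓ (x - q)}
  have hVc : Convex ℝ V := by
    refine (convex_ball q r).inter ?_
    have : {x | 0 < ℓ (x - q)} = {x | ℓ q < ℓ x} := by
      ext x
      simp
    rw [this]
    exact convex_halfSpace_gt ℓ.isLinear _
  have hcl : ∀ x ∈ Metric.ball q r, 0 ≤ ℓ (x - q) → x ∈ closure V := by
    intro x hx hxℓ
    have ht : Filter.Tendsto (fun ε : ℝ => x + ε • u) (𝓝[>] 0) (𝓝 x) := by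
      have : Continuous fun ε : ℝ => x + ε • u := by fun_prop
      have h2 := this.tendsto 0
      simp only [zero_smul, add_zero] at h2
      exact h2.mono_left nhdsWithin_le_nhds
    refine mem_closure_of_tendsto ht ?_
    filter_upwards [ht.eventually (Metric.isOpen_ball.mem_nhds hx), self_mem_nhdsWithin] with ε h1 h2
    refine ⟨h1, ?_⟩
    have : ℓ (x + ε • u - q) = ℓ (x - q) + ε := by
      rw [add_sub_right_comm, map_add, map_smul, hu, smul_eq_mul, mul_one]
    change 0 < ℓ (x + ε • u - q)
    rw [this]
    exact add_pos_of_nonneg_of_pos hxℓ h2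
  obtain ⟨y, hy⟩ : V.Nonempty :=
    closure_nonempty_iff.1 ⟨q, hcl q (Metric.mem_ball_self hr) (by simp)⟩
  obtain ⟨i, hi⟩ := mem_iUnion.1 (hcov hy.1)
  have hVS : V ⊆ S i := by
    refine hVc.isPreconnected.subset_of_disjoint_frontier (hS i) ⟨y, hy, hi⟩ ?_
    refine disjoint_left.2 fun x hx hxf => ?_
    have h0 := hfr i x ⟨hx.1, hxf⟩
    have h1 : 0 < ℓ (x - q) := hx.2
    rw [h0] at h1
    exact lt_irrefl _ h1
  exact ⟨i, fun x hx hxℓ => closure_minimal hVS (hS i) (hcl x hx hxℓ)⟩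

/-- A piecewise affine map is, off a set of codimension two, affine on either side of a hyperplane
(the linear form is zero at points where the map is affine). -/
theorem exists_isThin_two_sided_affine {ι : Type*} [Finite ι] {S : ι → Set F}
    (hS : ∀ i, IsClosed (S i)) (hfr : ∀ i, IsThin 1 (frontier (S i))) {α : ι → F →ᵃ[ℝ] E}
    {φ : F → E} {O : Set F} (hO : IsOpen O) (hcov : O ⊆ ⋃ i, S i)
    (hφ : ∀ i, ∀ q ∈ O ∩ S i, φ q = α i q) :
    ∃ T, IsThin 2 T ∧ ∀ q ∈ O \ T, ∃ (ℓ : F →ₗ[ℝ] ℝ) (i j : ι), ∀ᶠ x in 𝓝 q,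
      (0 ≤ ℓ (x - q) → φ x = α i x) ∧ (ℓ (x - q) ≤ 0 → φ x = α j x) := by
  have hall : IsThin 1 (⋃ i, frontier (S i)) := by
    have := isThin_biUnion (s := (univ : Set ι)) (c := 1) finite_univ fun i _ => hfr i
    simpa using this
  obtain ⟨𝓗, hfin, hne, hH⟩ := hall.exists_hyperplanes
  -- The intersections of non-parallel pairs among the hyperplanes that carry the frontiers.
  let T : Set F := ⋃ H ∈ {H ∈ 𝓗 ×ˢ 𝓗 | LinearMap.ker H.1.1 ≠ LinearMap.ker H.2.1},
    {x | H.1.1 x = H.1.2 ∧ H.2.1 x = H.2.2}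
  refine ⟨T, isThin_biUnion ((hfin.prod hfin).subset (sep_subset _ _)) ?_, ?_⟩
  · rintro ⟨H, H'⟩ ⟨⟨h1, h2⟩, h3⟩
    exact isThin_inter_hyperplanes _ _ h3 (hne _ h1) (hne _ h2)
  rintro q ⟨hqO, hqT⟩
  have hev : ∀ᶠ x in 𝓝 q, x ∈ O ∧ ∀ H ∈ 𝓗, H.1 q ≠ H.2 → H.1 x ≠ H.2 := by
    refine (hO.eventually_mem hqO).and ((Filter.eventually_all_finite hfin).2 fun H _ => ?_)
    by_cases hq : H.1 q = H.2
    · exact Filter.Eventually.of_forall fun x h => absurd hq h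
    · exact ((H.1.continuous_of_finiteDimensional.tendsto q).eventually_ne hq).mono fun x h _ => h
  obtain ⟨r, hr, hball⟩ := Metric.eventually_nhds_iff_ball.1 hev
  have hcov' : Metric.ball q r ⊆ ⋃ i, S i := fun x hx => hcov (hball x hx).1
  by_cases hq : ∃ H ∈ 𝓗, H.1 q = H.2
  · obtain ⟨⟨ℓ, c⟩, hHm, hHq⟩ := hq
    -- The ball meets only hyperplanes through `q`, and since `q` avoids `T` these all have the
    -- kernel of `ℓ`.
    have hzero : ∀ i, ∀ x ∈ Metric.ball q r ∩ frontier (S i), ℓ (x - q) = 0 := by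
      rintro i x ⟨hx, hxf⟩
      obtain ⟨H', hH', hxH'⟩ := hH x (mem_iUnion.2 ⟨i, hxf⟩)
      have hqH' : H'.1 q = H'.2 := by
        by_contra h
        exact (hball x hx).2 H' hH' h hxH'
      have hker : LinearMap.ker ℓ = LinearMap.ker H'.1 := by
        by_contra h
        exact hqT (mem_iUnion₂.2 ⟨((ℓ, c), H'), ⟨⟨hHm, hH'⟩, h⟩, hHq, hqH'⟩)
      rw [← LinearMap.mem_ker, hker, LinearMap.mem_ker, map_sub, hxH', hqH', sub_self]
    obtain ⟨i, hi⟩ := exists_piece_of_halfBall hS (hne _ hHm) hr hcov' hzero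
    obtain ⟨j, hj⟩ := exists_piece_of_halfBall hS (neg_ne_zero.2 (hne _ hHm)) hr hcov'
      fun i x hx => by rw [LinearMap.neg_apply, hzero i x hx, neg_zero]
    refine ⟨ℓ, i, j, Metric.eventually_nhds_iff_ball.2 ⟨r, hr, fun x hx => ⟨fun h => ?_, fun h => ?_⟩⟩⟩
    · exact hφ i x ⟨(hball x hx).1, hi x hx h⟩
    · exact hφ j x ⟨(hball x hx).1, hj x hx (by simpa using h)⟩
  · push Not at hq
    obtain ⟨i, hi⟩ := mem_iUnion.1 (hcov hqO)
    have hsub : Metric.ball q r ⊆ S i := by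
      refine (convex_ball q r).isPreconnected.subset_of_disjoint_frontier (hS i)
        ⟨q, Metric.mem_ball_self hr, hi⟩ (disjoint_left.2 fun x hx hxf => ?_)
      obtain ⟨H', hH', hxH'⟩ := hH x (mem_iUnion.2 ⟨i, hxf⟩)
      exact (hball x hx).2 H' hH' (hq H' hH') hxH'
    refine ⟨0, i, i, Metric.eventually_nhds_iff_ball.2 ⟨r, hr, fun x hx => ?_⟩⟩
    have := hφ i x ⟨(hball x hx).1, hsub hx⟩
    exact ⟨fun _ => this, fun _ => this⟩

end Hinge

/-! ### Linear algebra of bent hyperplanes -/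

section Hinge

open Module

variable {E : Type*} [NormedAddCommGroup E] [NormedSpace ℝ E] [FiniteDimensional ℝ E]
  {F : Type*} [NormedAddCommGroup F] [NormedSpace ℝ F]

theorem exists_dual_ker_eq_range {A : F →ₗ[ℝ] E} (hA : Function.Injective A)
    (hdim : finrank ℝ E = finrank ℝ F + 1) :
    ∃ t : E →ₗ[ℝ] ℝ, t ≠ 0 ∧ LinearMap.ker t = LinearMap.range A := by
  have hr := LinearMap.finrank_range_of_inj hA
  obtain ⟨t, ht, hle⟩ := (LinearMap.range A).exists_le_ker_of_lt_top
    (lt_top_iff_ne_top.2 fun h => by rw [h, finrank_top] at hr; omega)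
  refine ⟨t, ht, (Submodule.eq_of_le_of_finrank_eq hle ?_).symm⟩
  have := Module.Dual.finrank_ker_add_one_of_ne_zero ht
  omega

/-- A form cutting out the range of `A` vanishes on `A'` applied to the kernel of `ℓ`, so along `A'`
it is a multiple of `ℓ`. The multiple is nonzero because the range of `A'` sticks out, and can be
scaled to one. -/
theorem exists_dual_of_range_ne {A A' : F →ₗ[ℝ] E} {ℓ : F →ₗ[ℝ] ℝ} (hA : Function.Injective A)
    (hdim : finrank ℝ E = finrank ℝ F + 1) (hag : ∀ z, ℓ z = 0 → A z = A' z)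
    (hne : ¬ LinearMap.range A' ≤ LinearMap.range A) :
    ∃ t : E →ₗ[ℝ] ℝ, LinearMap.ker t = LinearMap.range A ∧ ∀ z, t (A' z) = ℓ z := by
  obtain ⟨t, ht, hker⟩ := exists_dual_ker_eq_range hA hdim
  have hzero : ∀ z, ℓ z = 0 → t (A' z) = 0 := fun z hz => by
    rw [← hag z hz, ← LinearMap.mem_ker, hker]
    exact LinearMap.mem_range_self A z
  obtain ⟨u, hu⟩ : ∃ u, ℓ u = 1 := by
    refine LinearMap.surjective (fun h => hne ?_) 1
    rintro _ ⟨z, rfl⟩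
    exact ⟨z, hag z (by rw [h]; rfl)⟩
  have hform : ∀ z, t (A' z) = ℓ z * t (A' u) := fun z => by
    have := hzero (z - ℓ z • u) (by simp [hu])
    rw [map_sub, map_sub, map_smul, map_smul, smul_eq_mul, sub_eq_zero] at this
    exact this
  have hc : t (A' u) ≠ 0 := by
    intro h
    refine hne ?_
    rintro _ ⟨z, rfl⟩
    rw [← hker, LinearMap.mem_ker, hform z, h, mul_zero]
  refine ⟨(t (A' u))⁻¹ • t, ?_, fun z => ?_⟩
  · rw [LinearMap.ker_smul _ _ (inv_ne_zero hc), hker]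
  · rw [LinearMap.smul_apply, hform z, smul_eq_mul]
    field_simp

/-- Two half-hyperplanes with a common edge, meeting only there, form the zero set of the minimum of
two linear forms. -/
theorem exists_min_eq_zero_iff {A₁ A₂ : F →ₗ[ℝ] E} {ℓ : F →ₗ[ℝ] ℝ} (h₁ : Function.Injective A₁)
    (h₂ : Function.Injective A₂) (hdim : finrank ℝ E = finrank ℝ F + 1)
    (hag : ∀ z, ℓ z = 0 → A₁ z = A₂ z)
    (hinj : ∀ z z', 0 ≤ ℓ z → ℓ z' ≤ 0 → A₁ z = A₂ z' → z = z') :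
    ∃ s t : E →ₗ[ℝ] ℝ, (∃ w, 0 < s w ∧ 0 < t w) ∧ ∀ y, min (s y) (t y) = 0 ↔
      (∃ z, 0 ≤ ℓ z ∧ A₁ z = y) ∨ ∃ z, ℓ z ≤ 0 ∧ A₂ z = y := by
  -- If both halves lie in one hyperplane, `hinj` forces them to fill it together, and one form
  -- taken twice suffices.
  by_cases hr : LinearMap.range A₁ = LinearMap.range A₂
  · obtain ⟨s, hs, hker⟩ := exists_dual_ker_eq_range h₁ hdim
    obtain ⟨w, hw⟩ := LinearMap.surjective hs 1
    refine ⟨s, s, ⟨w, by simp [hw]⟩, fun y => ?_⟩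
    rw [min_self, ← LinearMap.mem_ker]
    constructor
    · intro hy
      obtain ⟨z, hz⟩ := (hker ▸ hy : y ∈ LinearMap.range A₁)
      obtain ⟨z', hz'⟩ := (hr ▸ hker ▸ hy : y ∈ LinearMap.range A₂)
      by_contra! hno
      have h1 : ℓ z < 0 := not_le.1 fun h => hno.1 z h hz
      have h2 : 0 < ℓ z' := not_le.1 fun h => hno.2 z' h hz'
      have := hinj (-z) (-z') (by rw [map_neg]; linarith) (by rw [map_neg]; linarith)
        (by rw [map_neg, map_neg, hz, hz'])
      rw [neg_inj] at this
      rw [this] at h1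
      linarith
    · rintro (⟨z, -, rfl⟩ | ⟨z, -, rfl⟩)
      · rw [hker]
        exact LinearMap.mem_range_self _ _
      · rw [hker, hr]
        exact LinearMap.mem_range_self _ _
  · have hfr : finrank ℝ (LinearMap.range A₁) = finrank ℝ (LinearMap.range A₂) := by
      rw [LinearMap.finrank_range_of_inj h₁, LinearMap.finrank_range_of_inj h₂]
    -- The signs are chosen so that on each half one form vanishes and the other is nonnegative: `t`
    -- is zero along `A₁` and `-ℓ` along `A₂`, while `s` is `ℓ` along `A₁` and zero along `A₂`.
    obtain ⟨t, htk, ht⟩ := exists_dual_of_range_ne (A' := A₂) (ℓ := -ℓ) h₁ hdim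
      (fun z hz => hag z (by simpa using hz))
      fun h => hr (Submodule.eq_of_le_of_finrank_eq h hfr.symm).symm
    obtain ⟨s, hsk, hs⟩ := exists_dual_of_range_ne (A' := A₁) (ℓ := ℓ) h₂ hdim
      (fun z hz => (hag z hz).symm) fun h => hr (Submodule.eq_of_le_of_finrank_eq h hfr)
    have ht0 : ∀ z, t (A₁ z) = 0 := fun z => by
      rw [← LinearMap.mem_ker, htk]
      exact LinearMap.mem_range_self _ _
    have hs0 : ∀ z, s (A₂ z) = 0 := fun z => by
      rw [← LinearMap.mem_ker, hsk]
      exact LinearMap.mem_range_self _ _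
    have hℓ : ℓ ≠ 0 := by
      rintro rfl
      exact hr (by rw [LinearMap.ext fun z => hag z rfl])
    obtain ⟨u, hu⟩ := LinearMap.surjective hℓ 1
    refine ⟨s, t, ⟨A₁ u - A₂ u, ?_, ?_⟩, fun y => ?_⟩
    · rw [map_sub, hs, hs0, hu]
      norm_num
    · rw [map_sub, ht, ht0, LinearMap.neg_apply, hu]
      norm_num
    constructor
    · intro hmin
      rcases min_choice (s y) (t y) with h | h
      · have hsy : s y = 0 := h.symm.trans hmin
        obtain ⟨z, rfl⟩ : y ∈ LinearMap.range A₂ := hsk ▸ hsy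
        refine .inr ⟨z, ?_, rfl⟩
        have h3 := min_le_right (s (A₂ z)) (t (A₂ z))
        rw [hmin, ht, LinearMap.neg_apply] at h3
        linarith
      · have hty : t y = 0 := h.symm.trans hmin
        obtain ⟨z, rfl⟩ : y ∈ LinearMap.range A₁ := htk ▸ hty
        refine .inl ⟨z, ?_, rfl⟩
        have h3 := min_le_left (s (A₁ z)) (t (A₁ z))
        rwa [hmin, hs] at h3
    · rintro (⟨z, hz, rfl⟩ | ⟨z, hz, rfl⟩)
      · rw [hs, ht0, min_eq_right hz]
      · rw [hs0, ht, min_eq_left]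
        simpa using hz

end Hinge

/-! ### From a bent hyperplane to two-sidedness -/

section Hinge

open Module Filter

variable {E : Type*} [NormedAddCommGroup E] [NormedSpace ℝ E] [FiniteDimensional ℝ E]
  {F : Type*} [NormedAddCommGroup F] [NormedSpace ℝ F] [FiniteDimensional ℝ F]

/-- The image of a bent hyperplane under an embedding is locally the zero set of the minimum of two
linear forms. -/
theorem exists_local_min_eq_zero_iff (hdim : finrank ℝ E = finrank ℝ F + 1) {φ : F → E} {q : F}
    {B : Set E} {ℓ : F →ₗ[ℝ] ℝ} {α₁ α₂ : F →ᵃ[ℝ] E}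
    (hφ : ∀ᶠ x in 𝓝 q, (0 ≤ ℓ (x - q) → φ x = α₁ x) ∧ (ℓ (x - q) ≤ 0 → φ x = α₂ x))
    {O : Set F} (hO : O ∈ 𝓝 q) (hinj : InjOn φ O) (hB : ∀ᶠ x in 𝓝 q, φ x ∈ B)
    (hinv : ∀ V ∈ 𝓝 q, ∀ᶠ y in 𝓝 (φ q), y ∈ B → y ∈ φ '' V) :
    ∃ s t : E →ₗ[ℝ] ℝ, (∃ w, 0 < s w ∧ 0 < t w) ∧ ∀ᶠ y in 𝓝 (φ q),
      (y ∈ B ↔ min (s (y - φ q)) (t (y - φ q)) = 0) := by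
  have hq₁ : φ q = α₁ q := hφ.self_of_nhds.1 (by simp)
  have hq₂ : φ q = α₂ q := hφ.self_of_nhds.2 (by simp)
  have hα : ∀ α : F →ᵃ[ℝ] E, φ q = α q → ∀ z, α (q + z) = φ q + α.linear z := by
    intro α hα z
    have := α.map_vadd q z
    rw [vadd_eq_add, vadd_eq_add, ← hα] at this
    rw [add_comm q, this, add_comm]
  have hsmall : ∀ z, Tendsto (fun ε : ℝ => q + ε • z) (𝓝[>] 0) (𝓝 q) := by
    intro z
    have h1 : Continuous fun ε : ℝ => q + ε • z := by fun_prop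
    have h2 := h1.tendsto 0
    simp only [zero_smul, add_zero] at h2
    exact h2.mono_left nhdsWithin_le_nhds
  have hside₁ : ∀ z, 0 ≤ ℓ z → ∀ᶠ ε in 𝓝[>] (0 : ℝ), φ (q + ε • z) = φ q + ε • α₁.linear z := by
    intro z hz
    filter_upwards [(hsmall z).eventually hφ, self_mem_nhdsWithin] with ε h1 h2
    rw [h1.1 (by simpa using mul_nonneg (le_of_lt h2) hz), hα α₁ hq₁, map_smul]
  have hside₂ : ∀ z, ℓ z ≤ 0 → ∀ᶠ ε in 𝓝[>] (0 : ℝ), φ (q + ε • z) = φ q + ε • α₂.linear z := by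
    intro z hz
    filter_upwards [(hsmall z).eventually hφ, self_mem_nhdsWithin] with ε h1 h2
    rw [h1.2 (by simpa using mul_nonpos_of_nonneg_of_nonpos (le_of_lt h2) hz), hα α₂ hq₂, map_smul]
  -- Injectivity of `φ` near `q` passes to its one-sided derivatives: rays from `q` with the same
  -- image germ are equal.
  have huniq : ∀ (z z' : F) (a : E), (∀ᶠ ε in 𝓝[>] (0 : ℝ), φ (q + ε • z) = φ q + ε • a) →
      (∀ᶠ ε in 𝓝[>] (0 : ℝ), φ (q + ε • z') = φ q + ε • a) → z = z' := by
    intro z z' a h h'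
    obtain ⟨ε, e1, e2, e3, e4, e5⟩ := (h.and (h'.and (((hsmall z).eventually_mem hO).and
      (((hsmall z').eventually_mem hO).and self_mem_nhdsWithin)))).exists
    have := hinj e3 e4 (e1.trans e2.symm)
    exact smul_right_injective F (ne_of_gt e5) (add_left_cancel this)
  have hi₁ : Function.Injective α₁.linear := by
    refine (injective_iff_map_eq_zero _).2 fun z hz => ?_
    rcases le_total 0 (ℓ z) with h | h
    · refine huniq z 0 0 ?_ (by simp)
      simpa [hz] using hside₁ z h
    · refine neg_eq_zero.1 (huniq (-z) 0 0 ?_ (by simp))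
      simpa [hz] using hside₁ (-z) (by simpa using h)
  have hi₂ : Function.Injective α₂.linear := by
    refine (injective_iff_map_eq_zero _).2 fun z hz => ?_
    rcases le_total (ℓ z) 0 with h | h
    · refine huniq z 0 0 ?_ (by simp)
      simpa [hz] using hside₂ z h
    · refine neg_eq_zero.1 (huniq (-z) 0 0 ?_ (by simp))
      simpa [hz] using hside₂ (-z) (by simpa using h)
  have hag : ∀ z, ℓ z = 0 → α₁.linear z = α₂.linear z := by
    intro z hz
    obtain ⟨ε, e1, e2, e3⟩ := ((hside₁ z hz.ge).and ((hside₂ z hz.le).and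
      self_mem_nhdsWithin)).exists
    exact smul_right_injective E (ne_of_gt e3) (add_left_cancel (e1.symm.trans e2))
  obtain ⟨s, t, hw, hst⟩ := exists_min_eq_zero_iff hi₁ hi₂ hdim hag fun z z' hz hz' h =>
    huniq z z' _ (hside₁ z hz) (h ▸ hside₂ z' hz')
  refine ⟨s, t, hw, ?_⟩
  -- An injective linear map is antilipschitz, so small vectors have small preimages.
  have hnear : ∀ A : F →ₗ[ℝ] E, Function.Injective A → ∀ V ∈ 𝓝 q,
      ∀ᶠ y in 𝓝 (φ q), ∀ z, A z = y - φ q → q + z ∈ V := by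
    intro A hA V hV
    obtain ⟨K, hK, hlip⟩ := A.exists_antilipschitzWith (LinearMap.ker_eq_bot.2 hA)
    obtain ⟨r, hr, hball⟩ := Metric.mem_nhds_iff.1 hV
    have hK' : (0 : ℝ) < K := hK
    filter_upwards [Metric.ball_mem_nhds (φ q) (div_pos hr hK')] with y hy z hz
    refine hball ?_
    have h1 := hlip.le_mul_dist z 0
    rw [dist_zero_right, map_zero, dist_zero_right, hz, ← dist_eq_norm] at h1
    rw [Metric.mem_ball, lt_div_iff₀ hK'] at hy
    rw [Metric.mem_ball, dist_eq_norm, add_sub_cancel_left]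
    linarith
  filter_upwards [hinv _ hφ, hnear _ hi₁ _ (hφ.and hB), hnear _ hi₂ _ (hφ.and hB)]
    with y h1 h2 h3
  rw [hst]
  constructor
  · intro hy
    obtain ⟨x, hx, rfl⟩ := h1 hy
    have hxq : q + (x - q) = x := by abel
    rcases le_total 0 (ℓ (x - q)) with h | h
    · refine .inl ⟨x - q, h, ?_⟩
      rw [hx.1 h]
      conv_rhs => rw [← hxq, hα α₁ hq₁]
      abel
    · refine .inr ⟨x - q, h, ?_⟩
      rw [hx.2 h]
      conv_rhs => rw [← hxq, hα α₂ hq₂]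
      abel
  · rintro (⟨z, hz, hzy⟩ | ⟨z, hz, hzy⟩)
    · obtain ⟨e1, e2⟩ := h2 z hzy
      rw [e1.1 (by simpa using hz), hα α₁ hq₁, hzy] at e2
      simpa using e2
    · obtain ⟨e1, e2⟩ := h3 z hzy
      rw [e1.2 (by simpa using hz), hα α₂ hq₂, hzy] at e2
      simpa using e2

/-- In the chart the positive side is an intersection of two half-spaces and a ball, hence convex.
The negative side is a union of two convex sets that share points in direction `-w`. Moving from `B`
along `w` or `-w` enters either side. -/
theorem twoSidedAt_of_chart {X : Type*} [TopologicalSpace X] {B : Set X} {x : X}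
    (e : OpenPartialHomeomorph X E) (hx : x ∈ e.source) {s t : E →ₗ[ℝ] ℝ} {w : E}
    (hsw : 0 < s w) (htw : 0 < t w)
    (h : ∀ᶠ y in 𝓝 (e x), (e.symm y ∈ B ↔ min (s (y - e x)) (t (y - e x)) = 0)) :
    TwoSidedAt B x := by
  intro W hW
  have hsc : Continuous s := s.continuous_of_finiteDimensional
  have htc : Continuous t := t.continuous_of_finiteDimensional
  set b := e x with hb
  have hbt : b ∈ e.target := e.map_source hx
  have hsymm : ContinuousAt e.symm b := e.continuousAt_symm hbt
  have hWev : ∀ᶠ y in 𝓝 b, e.symm y ∈ W := hsymm.eventually (by rwa [hb, e.left_inv hx])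
  obtain ⟨r, hr, hball⟩ := Metric.eventually_nhds_iff_ball.1
    (h.and (hWev.and (e.open_target.eventually_mem hbt)))
  let V : Set E := Metric.ball b r
  have hVt : V ⊆ e.target := fun y hy => (hball y hy).2.2
  have hline : ∀ y ∈ V, ∀ u : E, Tendsto (fun ε : ℝ => y + ε • u) (𝓝[>] 0) (𝓝 y) ∧
      ∀ᶠ ε in 𝓝[>] (0 : ℝ), y + ε • u ∈ V := by
    intro y hy u
    have h1 : Continuous fun ε : ℝ => y + ε • u := by fun_prop
    have h2 := h1.tendsto 0
    simp only [zero_smul, add_zero] at h2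
    have h3 := h2.mono_left (nhdsWithin_le_nhds (s := Ioi 0))
    exact ⟨h3, h3.eventually (Metric.isOpen_ball.mem_nhds hy)⟩
  let P : Set E := V ∩ {y | 0 < min (s (y - b)) (t (y - b))}
  let N : Set E := V ∩ {y | min (s (y - b)) (t (y - b)) < 0}
  have hPV : P ⊆ V := inter_subset_left
  have hNV : N ⊆ V := inter_subset_left
  have hcm : Continuous fun y => min (s (y - b)) (t (y - b)) := by fun_prop
  have hPo : IsOpen P := Metric.isOpen_ball.inter (isOpen_lt continuous_const hcm)
  have hNo : IsOpen N := Metric.isOpen_ball.inter (isOpen_lt hcm continuous_const)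
  have hpos : ∀ l : E →ₗ[ℝ] ℝ, Convex ℝ {y | 0 < l (y - b)} := fun l => by
    simpa using convex_halfSpace_gt l.isLinear (l b)
  have hneg : ∀ l : E →ₗ[ℝ] ℝ, Convex ℝ {y | l (y - b) < 0} := fun l => by
    simpa using convex_halfSpace_lt l.isLinear (l b)
  have hPc : IsPreconnected P := by
    have : P = V ∩ ({y | 0 < s (y - b)} ∩ {y | 0 < t (y - b)}) := by
      ext y
      simp [P]
    rw [this]
    exact ((convex_ball b r).inter ((hpos s).inter (hpos t))).isPreconnected
  have hNc : IsPreconnected N := by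
    have : N = (V ∩ {y | s (y - b) < 0}) ∪ (V ∩ {y | t (y - b) < 0}) := by
      ext y
      simp [N, ← and_or_left]
    rw [this]
    obtain ⟨ε, h1, h2⟩ := ((hline b (Metric.mem_ball_self hr) (-w)).2.and
      self_mem_nhdsWithin).exists
    refine IsPreconnected.union (b + ε • -w) ⟨h1, ?_⟩ ⟨h1, ?_⟩
      ((convex_ball b r).inter (hneg s)).isPreconnected
      ((convex_ball b r).inter (hneg t)).isPreconnected
    · simpa using mul_pos h2 hsw
    · simpa using mul_pos h2 htw
  have himg : ∀ Q ⊆ V, IsOpen Q → IsOpen (e.symm '' Q) := fun Q hQ hQo =>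
    e.symm.isOpen_image_of_subset_source hQo (hQ.trans hVt)
  have hpre : ∀ Q ⊆ V, IsPreconnected Q → IsPreconnected (e.symm '' Q) := fun Q hQ hQp =>
    hQp.image _ (e.continuousOn_symm.mono (hQ.trans hVt))
  have hcl : ∀ Q ⊆ V, ∀ y ∈ V, ∀ u : E, (∀ᶠ ε in 𝓝[>] (0 : ℝ), y + ε • u ∈ Q) →
      e.symm y ∈ closure (e.symm '' Q) := by
    intro Q _ y hy u hQ
    exact mem_closure_of_tendsto ((e.continuousAt_symm (hVt hy)).tendsto.comp (hline y hy u).1)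
      (hQ.mono fun ε hε => mem_image_of_mem _ hε)
  have hxV : x ∈ e.symm '' V := ⟨b, Metric.mem_ball_self hr, e.left_inv hx⟩
  refine ⟨e.symm '' V, e.symm '' P, e.symm '' N, ?_, himg V subset_rfl Metric.isOpen_ball, hxV,
    himg P hPV hPo, himg N hNV hNo, hpre P hPV hPc, hpre N hNV hNc, ?_, ?_, ?_, ?_⟩
  · rintro _ ⟨y, hy, rfl⟩
    exact (hball y hy).2.1
  · refine disjoint_left.2 ?_
    rintro _ ⟨y, hy, rfl⟩ ⟨y', hy', heq⟩
    rw [e.symm.injOn (hVt hy'.1) (hVt hy.1) heq] at hy'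
    have h1 : 0 < min (s (y - b)) (t (y - b)) := hy.2
    exact lt_asymm h1 hy'.2
  · ext z
    constructor
    · rintro ⟨⟨y, hy, rfl⟩, hz⟩
      rw [(hball y hy).1] at hz
      rcases lt_or_gt_of_ne hz with h | h
      · exact .inr ⟨y, ⟨hy, h⟩, rfl⟩
      · exact .inl ⟨y, ⟨hy, h⟩, rfl⟩
    · rintro (⟨y, hy, rfl⟩ | ⟨y, hy, rfl⟩)
      · exact ⟨⟨y, hy.1, rfl⟩, fun hz => ne_of_gt hy.2 ((hball y hy.1).1.1 hz)⟩
      · exact ⟨⟨y, hy.1, rfl⟩, fun hz => ne_of_lt hy.2 ((hball y hy.1).1.1 hz)⟩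
  · rintro _ ⟨⟨y, hy, rfl⟩, hyB⟩
    have h0 := (hball y hy).1.1 hyB
    refine hcl P hPV y hy w ?_
    filter_upwards [(hline y hy w).2, self_mem_nhdsWithin] with ε h1 h2
    refine ⟨h1, ?_⟩
    have hs0 : 0 ≤ s (y - b) := h0 ▸ min_le_left _ _
    have ht0 : 0 ≤ t (y - b) := h0 ▸ min_le_right _ _
    have hε : 0 < ε := h2
    simp only [mem_ofPred_eq, add_sub_right_comm, map_add, map_smul, smul_eq_mul, lt_min_iff]
    constructor <;> positivity
  · rintro _ ⟨⟨y, hy, rfl⟩, hyB⟩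
    have h0 := (hball y hy).1.1 hyB
    refine hcl N hNV y hy (-w) ?_
    filter_upwards [(hline y hy (-w)).2, self_mem_nhdsWithin] with ε h1 h2
    refine ⟨h1, ?_⟩
    have hε : 0 < ε := h2
    have e1 := mul_pos hε hsw
    have e2 := mul_pos hε htw
    simp only [mem_ofPred_eq, add_sub_right_comm, map_add, map_smul, map_neg, smul_eq_mul, min_lt_iff,
      mul_neg]
    rcases min_choice (s (y - b)) (t (y - b)) with h | h
    · left
      rw [h0] at h
      linarith
    · right
      rw [h0] at h
      linarith

end Hinge

/-! ### From thinness in charts to two components -/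

section Charts

open Module Filter

variable {X : Type*} [TopologicalSpace X] {B : Set X}

theorem IsPreconnected.of_dense_local {B G : Set X} (hB : IsPreconnected B) (hGB : G ⊆ B)
    (hd : B ⊆ closure G) (h : ∀ x ∈ B, ∃ V ∈ 𝓝[B] x, IsPreconnected (V ∩ G)) :
    IsPreconnected G := by
  have hpc : PreconnectedSpace B := isPreconnected_iff_preconnectedSpace.1 hB
  have himg : Subtype.val '' (Subtype.val ⁻¹' G : Set B) = G := by
    rw [Subtype.image_preimage_coe, inter_eq_right.2 hGB]
  have hd' : Dense (Subtype.val ⁻¹' G : Set B) := fun x => by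
    rw [closure_subtype, himg]
    exact hd x.2
  have := hd'.isPreconnected_of_local fun x => by
    obtain ⟨V, hV, hVp⟩ := h x x.2
    refine ⟨Subtype.val ⁻¹' V, ?_, ?_⟩
    · rw [mem_nhds_subtype_iff_nhdsWithin, Subtype.image_preimage_coe]
      exact inter_mem self_mem_nhdsWithin hV
    · rw [← preimage_inter, ← IsInducing.subtypeVal.isPreconnected_image,
        Subtype.image_preimage_coe, inter_eq_right.2 (inter_subset_right.trans hGB)]
      exact hVp
  rw [← himg]
  exact this.image _ continuous_subtype_val.continuousOn

theorem dense_compl_of_subset_closure_twoSided (hG : B ⊆ closure (B \ badSet B)) : Dense Bᶜ := by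
  have h1 : B \ badSet B ⊆ closure Bᶜ := by
    rintro b ⟨hb, hbK⟩
    have h : TwoSidedAt B b := by
      by_contra h
      exact hbK ⟨hb, h⟩
    obtain ⟨U, U₁, U₂, -, -, hbU, -, -, -, -, -, hUB, c₁, -⟩ := h univ univ_mem
    refine closure_mono ?_ (c₁ ⟨hbU, hb⟩)
    exact fun y hy => (hUB.symm ▸ (Or.inl hy : y ∈ U₁ ∪ U₂) : y ∈ U \ B).2
  intro x
  by_cases hx : x ∈ B
  · exact closure_minimal h1 isClosed_closure (hG hx)
  · exact subset_closure hx

theorem OpenPartialHomeomorph.exists_ball_image_subset {E : Type*} [PseudoMetricSpace E]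
    (e : OpenPartialHomeomorph X E) {x : X} (hx : x ∈ e.source) {W : Set X} (hW : W ∈ 𝓝 x)
    {U : Set E} (hU : U ∈ 𝓝 (e x)) :
    ∃ r > 0, Metric.ball (e x) r ⊆ e.target ∧ Metric.ball (e x) r ⊆ U ∧
      e.symm '' Metric.ball (e x) r ⊆ W ∧ e.symm '' Metric.ball (e x) r ∈ 𝓝 x := by
  have h1 : ∀ᶠ y in 𝓝 (e x), e.symm y ∈ W :=
    (e.continuousAt_symm (e.map_source hx)).eventually (by rwa [e.left_inv hx])
  obtain ⟨r, hr, hball⟩ := Metric.eventually_nhds_iff_ball.1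
    ((e.open_target.eventually_mem (e.map_source hx)).and (h1.and hU))
  have ht : Metric.ball (e x) r ⊆ e.target := fun y hy => (hball y hy).1
  refine ⟨r, hr, ht, fun y hy => (hball y hy).2.2, ?_, ?_⟩
  · rintro _ ⟨y, hy, rfl⟩
    exact (hball y hy).2.1
  · exact (e.symm.isOpen_image_of_subset_source Metric.isOpen_ball ht).mem_nhds
      ⟨e x, Metric.mem_ball_self hr, e.left_inv hx⟩

variable {E : Type*} [NormedAddCommGroup E] [NormedSpace ℝ E] [FiniteDimensional ℝ E]

theorem OpenPartialHomeomorph.exists_nhds_isPreconnected_diff (e : OpenPartialHomeomorph X E)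
    {x : X} (hx : x ∈ e.source) {K : Set X} (hK : IsThin 2 (e '' (e.source ∩ K))) :
    ∀ W ∈ 𝓝 x, ∃ V ∈ 𝓝 x, V ⊆ W ∧ IsPreconnected (V \ K) := by
  intro W hW
  obtain ⟨r, hr, ht, -, hVW, hV⟩ := e.exists_ball_image_subset hx hW univ_mem
  refine ⟨_, hV, hVW, ?_⟩
  have heq : e.symm '' Metric.ball (e x) r \ K =
      e.symm '' (Metric.ball (e x) r \ (e.symm ⁻¹' K ∩ e.target)) := by
    ext z
    constructor
    · rintro ⟨⟨y, hy, rfl⟩, hz⟩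
      exact ⟨y, ⟨hy, fun h => hz h.1⟩, rfl⟩
    · rintro ⟨y, ⟨hy, hyK⟩, rfl⟩
      exact ⟨⟨y, hy, rfl⟩, fun h => hyK ⟨h, ht hy⟩⟩
  rw [heq]
  refine (IsThin.isPreconnected_diff (hK.mono ?_) Metric.isOpen_ball (convex_ball _ _)).image _
    (e.continuousOn_symm.mono (sdiff_subset.trans ht))
  rintro y ⟨hy, hyt⟩
  exact ⟨e.symm y, ⟨e.map_target hyt, hy⟩, e.right_inv hyt⟩

/-- A ball of the chart contains an open star-shaped set that avoids the bad set and fills the ball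
up to codimension two. Being contractible, it is simply connected, so separators can be glued on it
and extended to the ball. -/
theorem exists_sepAt_of_chart [LocallyPathConnectedSpace X] (hB : IsClosed B)
    (hV : ∀ x, ∀ W ∈ 𝓝 x, ∃ V ∈ 𝓝 x, V ⊆ W ∧ IsPreconnected (V \ badSet B))
    (hG : B ⊆ closure (B \ badSet B)) {x : X} (e : OpenPartialHomeomorph X E)
    (hx : x ∈ e.source) (hK : IsThin 3 (e '' (e.source ∩ badSet B))) :
    ∃ f, ∀ᶠ y in 𝓝 x, SepAt B f y := by
  obtain ⟨r, hr, ht, -, -, -⟩ := e.exists_ball_image_subset hx univ_mem univ_mem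
  let U := Metric.ball (e x) r
  obtain ⟨T, hTU, hTo, hTK, ⟨z, hzT, hstar⟩, hthin⟩ := hK.exists_starConvex
    (U := U) Metric.isOpen_ball (convex_ball _ _) ⟨e x, Metric.mem_ball_self hr⟩
  have hTt : T ⊆ e.target := hTU.trans ht
  have hcontr : ContractibleSpace T := hstar.contractibleSpace ⟨z, hzT⟩
  let Φ : T ≃ₜ (e.symm '' T : Set X) := e.symm.homeomorphOfImageSubsetSource hTt rfl
  have hcontr' : ContractibleSpace (e.symm '' T : Set X) := Φ.symm.contractibleSpace
  have hD : IsOpen (e.symm '' U) := e.symm.isOpen_image_of_subset_source Metric.isOpen_ball ht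
  refine exists_sepAt_of_simplyConnected hB (dense_compl_of_subset_closure_twoSided hG) hV hG
    (D := e.symm '' U) (T := e.symm '' T) hD ⟨e x, Metric.mem_ball_self hr, e.left_inv hx⟩
    (e.symm.isOpen_image_of_subset_source hTo hTt) ?_ ?_ ?_
  · refine disjoint_left.2 ?_
    rintro _ ⟨y, hy, rfl⟩ hyK
    exact disjoint_left.1 hTK hy ⟨e.symm y, ⟨e.map_target (hTt hy), hyK⟩, e.right_inv (hTt hy)⟩
  · rintro _ ⟨y, hy, rfl⟩
    have hyT : y ∈ closure T := by
      have := Metric.isOpen_ball.subset_closure_diff_of_isThin (hthin.of_le one_le_two) hy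
      refine closure_mono ?_ this
      rintro w ⟨hw, hwT⟩
      by_contra h
      exact hwT ⟨hw, h⟩
    exact mem_closure_image (e.continuousAt_symm (ht hy)) hyT
  · rintro _ ⟨y, hy, rfl⟩ W hW
    have hys : e.symm y ∈ e.source := e.map_target (ht hy)
    obtain ⟨ρ, hρ, hρt, hρU, hVW, hVn⟩ := e.exists_ball_image_subset hys hW (U := U)
      (by rw [e.right_inv (ht hy)]; exact Metric.isOpen_ball.mem_nhds hy)
    refine ⟨_, hVn, hVW, ?_⟩
    have heq : e.symm '' Metric.ball (e (e.symm y)) ρ ∩ e.symm '' T =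
        e.symm '' (Metric.ball (e (e.symm y)) ρ \ (U \ T)) := by
      rw [← e.symm.injOn.image_inter hρt hTt]
      congr 1
      ext w
      constructor
      · exact fun hw => ⟨hw.1, fun h => h.2 hw.2⟩
      · rintro ⟨hw, hw'⟩
        refine ⟨hw, ?_⟩
        by_contra h
        exact hw' ⟨hρU hw, h⟩
    rw [heq]
    exact (hthin.isPreconnected_diff Metric.isOpen_ball (convex_ball _ _)).image _
      (e.continuousOn_symm.mono (sdiff_subset.trans hρt))

/-- A closed subset with a connected dense set of two-sided points, whose remaining points have
codimension three, separates a simply connected space into exactly two components. -/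
theorem card_connectedComponents_of_charts [SimplyConnectedSpace X] [LocallyPathConnectedSpace X]
    (hB : IsClosed B) (hne : B.Nonempty)
    (hchart : ∀ x ∈ B, ∃ e : OpenPartialHomeomorph X E, x ∈ e.source ∧
      IsThin 3 (e '' (e.source ∩ badSet B)))
    (hG : B ⊆ closure (B \ badSet B)) (hGp : IsPreconnected (B \ badSet B)) {Z : Type*}
    [TopologicalSpace Z] {j : Z → X} (hj : IsEmbedding j) (hjr : range j = Bᶜ) :
    Nat.card (ConnectedComponents Z) = 2 := by
  have hd := dense_compl_of_subset_closure_twoSided hG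
  have hV : ∀ x, ∀ W ∈ 𝓝 x, ∃ V ∈ 𝓝 x, V ⊆ W ∧ IsPreconnected (V \ badSet B) := by
    intro x
    by_cases hx : x ∈ B
    · obtain ⟨e, hxe, hK⟩ := hchart x hx
      exact e.exists_nhds_isPreconnected_diff hxe (hK.of_le (by norm_num))
    · intro W hW
      obtain ⟨V, ⟨hVo, hxV, hVc⟩, hVW⟩ := (LocallyConnectedSpace.open_connected_basis x).mem_iff.1
        (inter_mem hW (hB.isOpen_compl.mem_nhds hx))
      rw [id] at hVW
      refine ⟨V, hVo.mem_nhds hxV, fun y hy => (hVW hy).1, ?_⟩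
      rw [sdiff_eq_left.2 (disjoint_left.2 fun y hy hyK => (hVW hy).2 hyK.1)]
      exact hVc.isPreconnected
  obtain ⟨f, hf⟩ := exists_global_separator hB hd hV fun x => by
    by_cases hx : x ∈ B
    · obtain ⟨e, hxe, hK⟩ := hchart x hx
      exact exists_sepAt_of_chart hB hV hG e hxe hK
    · exact exists_sepAt_of_notMem hB hx
  obtain ⟨b, hb⟩ := hne
  exact card_connectedComponents_of_separator hB hd hV (closure_nonempty_iff.1 ⟨b, hG hb⟩) hGp hf
    hj hjr

end Charts

/-! ### Piecewise linear maps and charts -/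

section PiecewiseLinear

open Module Filter

variable {E : Type*} [NormedAddCommGroup E] [NormedSpace ℝ E]
  {F : Type*} [NormedAddCommGroup F] [NormedSpace ℝ F]

theorem IsConvexCell.isCompact {C : Set E} (h : IsConvexCell C) : IsCompact C := by
  obtain ⟨s, hs, rfl⟩ := h
  exact hs.isCompact_convexHull ℝ

theorem IsCompactPolyhedron.isCompact {P : Set E} (h : IsCompactPolyhedron P) : IsCompact P := by
  obtain ⟨𝒞, h1, h2, rfl⟩ := h
  exact h1.isCompact_sUnion fun C hC => (h2 C hC).isCompact

theorem IsPLOn.continuousOn [FiniteDimensional ℝ E] {f : E → F} {P : Set E} (h : IsPLOn f P) :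
    ContinuousOn f P := by
  obtain ⟨𝒞, ⟨h1, h2, rfl⟩, h3⟩ := h
  have : Finite 𝒞 := h1
  rw [sUnion_eq_iUnion]
  refine (locallyFinite_of_finite _).continuousOn_iUnion
    (fun C => (h2 C C.2).isCompact.isClosed) fun C => ?_
  obtain ⟨a, ha⟩ := h3 C C.2
  exact a.continuous_of_finiteDimensional.continuousOn.congr ha

/-- The domains of affinity of a composition of piecewise linear maps. -/
theorem IsPLOn.exists_pieces_comp.{u, v, w} {E : Type u} [NormedAddCommGroup E] [NormedSpace ℝ E]
    {F : Type v} [NormedAddCommGroup F] [NormedSpace ℝ F] [FiniteDimensional ℝ F]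
    {G : Type w} [NormedAddCommGroup G] [NormedSpace ℝ G] {g : F → E} {f : E → G} {Q : Set F} {N : Set E}
    (hg : IsPLOn g Q) (hf : IsPLOn f N) :
    ∃ (ι : Type max u v) (_ : Finite ι) (S : ι → Set F) (α : ι → F →ᵃ[ℝ] G), (∀ i, IsClosed (S i)) ∧
      (∀ i, IsThin 1 (frontier (S i))) ∧ (∀ q ∈ Q, g q ∈ N → q ∈ ⋃ i, S i) ∧
      ∀ i, ∀ q ∈ S i, f (g q) = α i q := by
  obtain ⟨𝒞, ⟨c1, c2, rfl⟩, c3⟩ := hg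
  obtain ⟨𝒟, ⟨d1, d2, rfl⟩, d3⟩ := hf
  choose! a ha using c3
  choose! b hb using d3
  have : Finite 𝒞 := c1
  have : Finite 𝒟 := d1
  -- The cell of `f` is pulled back along the affine map extending `g`, rather than along `g`, so
  -- that the frontier of each piece is thin.
  refine ⟨𝒞 × 𝒟, inferInstance, fun i => i.1 ∩ a i.1 ⁻¹' i.2, fun i => (b i.2).comp (a i.1), ?_,
    ?_, ?_, ?_⟩
  · rintro ⟨⟨C, hC⟩, ⟨D, hD⟩⟩
    exact (c2 C hC).isCompact.isClosed.inter
      ((d2 D hD).isCompact.isClosed.preimage (a C).continuous_of_finiteDimensional)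
  · rintro ⟨⟨C, hC⟩, ⟨D, hD⟩⟩
    have t1 : IsThin 1 (frontier C) := by
      obtain ⟨s, hs, rfl⟩ := c2 C hC
      exact isThin_frontier_preimage_convexHull (AffineMap.id ℝ F) hs
    have t2 : IsThin 1 (frontier (a C ⁻¹' D)) := by
      obtain ⟨s, hs, rfl⟩ := d2 D hD
      exact isThin_frontier_preimage_convexHull (a C) hs
    exact (t1.union t2).mono ((frontier_inter_subset _ _).trans
      (union_subset_union inter_subset_left inter_subset_right))
  · rintro q ⟨C, hC, hq⟩ ⟨D, hD, hgq⟩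
    refine mem_iUnion.2 ⟨(⟨C, hC⟩, ⟨D, hD⟩), hq, ?_⟩
    rwa [mem_preimage, ← ha C hC hq]
  · rintro ⟨⟨C, hC⟩, ⟨D, hD⟩⟩ q ⟨hqC, hqD⟩
    rw [AffineMap.comp_apply, ← hb D hD hqD, ha C hC hqC]

theorem IsPLChartAt.mem [FiniteDimensional ℝ E] {m : ℕ} {P N : Set E} {x : E} {f : E → Fin m → ℝ}
    {g : (Fin m → ℝ) → E} (h : IsPLChartAt m P x N f g) (hx : x ∈ P) : x ∈ N :=
  mem_of_mem_nhdsWithin hx h.2.1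

theorem IsPLChartAt.tendsto_symm [FiniteDimensional ℝ E] {m : ℕ} {P N : Set E} {x : E}
    {f : E → Fin m → ℝ} {g : (Fin m → ℝ) → E} (h : IsPLChartAt m P x N f g) (hx : x ∈ P) :
    Tendsto g (𝓝[stdCube m] (f x)) (𝓝[P] x) := by
  obtain ⟨hNP, hN, hf, hg, hfm, hgm, hinv⟩ := id h
  have hxN := h.mem hx
  refine tendsto_nhdsWithin_iff.2 ⟨?_, ?_⟩
  · have := hg.continuousOn (f x) (hfm hxN)
    rwa [ContinuousWithinAt, hinv.1 hxN] at this
  · filter_upwards [self_mem_nhdsWithin] with y hy using hNP (hgm hy)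

theorem IsPLChartAt.image_mem_nhdsWithin [FiniteDimensional ℝ E] {m : ℕ} {P N : Set E} {x : E}
    {f : E → Fin m → ℝ} {g : (Fin m → ℝ) → E} (h : IsPLChartAt m P x N f g) (hx : x ∈ P)
    {U : Set (Fin m → ℝ)} (hU : U ∈ 𝓝 (f x)) : g '' (stdCube m ∩ U) ∈ 𝓝[P] x := by
  obtain ⟨hNP, hN, hf, hg, hfm, hgm, hinv⟩ := id h
  have hxN := h.mem hx
  have hc : ContinuousWithinAt f P x := (hf.continuousOn x hxN).mono_of_mem_nhdsWithin hN
  filter_upwards [hN, hc hU] with y hy hyU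
  exact ⟨f y, ⟨hfm hy, hyU⟩, hinv.1 hy⟩

/-- The cube meets a ball in a convex set, also at its boundary, and such sets are carried to `P` by
the inverse chart. -/
theorem IsPLManifold.locallyPathConnectedSpace [FiniteDimensional ℝ E] {m : ℕ} {P : Set E}
    (h : IsPLManifold m P) : LocallyPathConnectedSpace P := by
  refine ⟨fun x => hasBasis_self.2 fun W hW => ?_⟩
  obtain ⟨N, f, g, hch⟩ := h.2 x x.2
  obtain ⟨hNP, hN, hf, hg, hfm, hgm, hinv⟩ := id hch
  have hxN := hch.mem x.2
  rw [mem_nhds_subtype_iff_nhdsWithin] at hW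
  obtain ⟨r, hr, hball⟩ := Metric.mem_nhdsWithin_iff.1 (hch.tendsto_symm x.2 hW)
  let V : Set (Fin m → ℝ) := stdCube m ∩ Metric.ball (f x) r
  have hVN : g '' V ⊆ N := by
    rintro _ ⟨y, hy, rfl⟩
    exact hgm hy.1
  have hval : Subtype.val '' (Subtype.val ⁻¹' (g '' V) : Set P) = g '' V := by
    rw [Subtype.image_preimage_coe, inter_eq_right.2 (hVN.trans hNP)]
  refine ⟨Subtype.val ⁻¹' (g '' V), ?_, ?_, ?_⟩
  · rw [mem_nhds_subtype_iff_nhdsWithin, hval]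
    exact hch.image_mem_nhdsWithin x.2 (Metric.ball_mem_nhds _ hr)
  · rw [IsInducing.subtypeVal.isPathConnected_iff, hval]
    refine IsPathConnected.image' ?_ (hg.continuousOn.mono inter_subset_left)
    exact ((convex_Icc 0 1).inter (convex_ball _ _)).isPathConnected
      ⟨f x, hfm hxN, Metric.mem_ball_self hr⟩
  · intro y hy
    obtain ⟨z, hz, hzy⟩ := hy
    obtain ⟨w, hw, hwz⟩ := hball ⟨hz.2, hz.1⟩
    have : w = y := Subtype.ext (hwz.trans hzy)
    exact this ▸ hw

/-- An interior chart of a piecewise linear manifold gives arbitrarily small open charts. -/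
theorem IsPLChartAt.exists_openPartialHomeomorph [FiniteDimensional ℝ E] {m : ℕ} {P N : Set E}
    {x : P} {f : E → Fin m → ℝ} {g : (Fin m → ℝ) → E} (h : IsPLChartAt m P x N f g)
    (hint : f x ∈ interior (stdCube m)) {W : Set P} (hW : W ∈ 𝓝 x) :
    ∃ e : OpenPartialHomeomorph P (Fin m → ℝ), x ∈ e.source ∧ e.source ⊆ W ∧
      ∀ y : P, e y = f y := by
  classical
  obtain ⟨hNP, hN, hf, hg, hfm, hgm, hinv⟩ := id h
  have hxN := h.mem x.2
  have hN' : (Subtype.val ⁻¹' N : Set P) ∈ 𝓝 x := by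
    rw [mem_nhds_subtype_iff_nhdsWithin, Subtype.image_preimage_coe, inter_eq_right.2 hNP]
    exact hN
  obtain ⟨O, hOsub, hO, hxO⟩ := mem_nhds_iff.1 (inter_mem hW hN')
  have hON : ∀ y ∈ O, (y : E) ∈ N := fun y hy => (hOsub hy).2
  have hOP : Subtype.val '' O ∈ 𝓝[P] (x : E) :=
    mem_nhds_subtype_iff_nhdsWithin.1 (mem_of_superset (hO.mem_nhds hxO) subset_rfl)
  have hev := h.tendsto_symm x.2 hOP
  rw [mem_map, nhdsWithin_eq_nhds.2 (mem_interior_iff_mem_nhds.1 hint)] at hev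
  obtain ⟨r, hr, hball⟩ := Metric.mem_nhds_iff.1
    (inter_mem hev (mem_interior_iff_mem_nhds.1 hint))
  let G : (Fin m → ℝ) → P := fun y => if hy : g y ∈ P then ⟨g y, hy⟩ else x
  have hGv : ∀ y ∈ stdCube m, (G y : E) = g y := fun y hy => by
    simp [G, hNP (hgm hy)]
  have hGO : ∀ y ∈ Metric.ball (f x) r, G y ∈ O := fun y hy => by
    obtain ⟨w, hw, hwy⟩ := (hball hy).1
    have : w = G y := Subtype.ext (hwy.trans (hGv y (hball hy).2).symm)
    exact this ▸ hw
  have hfO : ContinuousOn (fun y : P => f y) O :=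
    hf.continuousOn.comp continuous_subtype_val.continuousOn hON
  refine ⟨{ toFun := fun y => f y
            invFun := G
            source := O ∩ (fun y : P => f y) ⁻¹' Metric.ball (f x) r
            target := Metric.ball (f x) r
            map_source' := fun y hy => hy.2
            map_target' := fun y hy => ⟨hGO y hy, ?_⟩
            left_inv' := fun y hy => Subtype.ext ?_
            right_inv' := fun y hy => ?_
            open_source := hfO.isOpen_inter_preimage hO Metric.isOpen_ball
            open_target := Metric.isOpen_ball
            continuousOn_toFun := hfO.mono inter_subset_left
            continuousOn_invFun := ?_ }, ⟨hxO, Metric.mem_ball_self hr⟩, ?_, ?_⟩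
  · rw [mem_preimage, hGv y (hball hy).2, hinv.2 (hball hy).2]
    exact hy
  · rw [hGv _ (hfm (hON y hy.1)), hinv.1 (hON y hy.1)]
  · rw [hGv y (hball hy).2, hinv.2 (hball hy).2]
  · rw [IsInducing.subtypeVal.continuousOn_iff]
    exact (hg.continuousOn.mono fun y hy => (hball hy).2).congr fun y hy => hGv y (hball hy).2
  · exact fun y hy => (hOsub hy.1).1
  · exact fun y => rfl

end PiecewiseLinear

/-! ### The bad set has codimension three -/

section PiecewiseLinear

open Module Filter

/-- The local structure of a closed codimension-one submanifold: near each of its points it is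
two-sided off a set of codimension two in the submanifold, hence three in the ambient manifold. -/
theorem exists_chart_isThin_badSet {E : Type*} [NormedAddCommGroup E] [NormedSpace ℝ E]
    [FiniteDimensional ℝ E] {k : ℕ} {M B : Set E} (hBM : B ⊆ plInterior (k + 1) M)
    (hB : B ⊆ plInterior k B) {x : M} (hx : (x : E) ∈ B) :
    ∃ e : OpenPartialHomeomorph M (Fin (k + 1) → ℝ), x ∈ e.source ∧
      IsThin 3 (e '' (e.source ∩ badSet (Subtype.val ⁻¹' B))) ∧
      x ∈ closure (Subtype.val ⁻¹' B \ badSet (Subtype.val ⁻¹' B)) ∧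
      ∃ V ∈ 𝓝[Subtype.val ⁻¹' B] x, V ⊆ Subtype.val ⁻¹' B ∧
        IsPreconnected (V \ badSet (Subtype.val ⁻¹' B)) := by
  classical
  set B' : Set M := Subtype.val ⁻¹' B with hB'
  have hBsub : B ⊆ M := fun y hy => (hBM hy).1
  obtain ⟨-, N, f, g, hch, hint⟩ := hBM hx
  obtain ⟨-, N', f', g', hch', hint'⟩ := hB hx
  obtain ⟨hNM, hN, hf, hg, hfm, hgm, hinv⟩ := id hch
  obtain ⟨hNB, hN', hf', hg', hfm', hgm', hinv'⟩ := id hch'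
  have hxN := hch.mem x.2
  have hxN' := hch'.mem hx
  have hcube : stdCube k ∈ 𝓝 (f' x) := mem_interior_iff_mem_nhds.1 hint'
  have hg'x : Tendsto g' (𝓝 (f' x)) (𝓝[B] (x : E)) := by
    have := hch'.tendsto_symm hx
    rwa [nhdsWithin_eq_nhds.2 hcube] at this
  -- the parameter domain
  obtain ⟨ρ, hρ, hball⟩ := Metric.mem_nhds_iff.1
    (inter_mem hcube (hg'x.mono_right (nhdsWithin_mono _ hBsub) hN))
  set O : Set (Fin k → ℝ) := Metric.ball (f' x) ρ
  have hOo : IsOpen O := Metric.isOpen_ball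
  have hOc : ∀ q ∈ O, q ∈ stdCube k := fun q hq => (hball hq).1
  have hON : ∀ q ∈ O, g' q ∈ N := fun q hq => (hball hq).2
  have hOB : ∀ q ∈ O, g' q ∈ B := fun q hq => hNB (hgm' (hOc q hq))
  let γ : (Fin k → ℝ) → M := fun q => if hq : g' q ∈ M then ⟨g' q, hq⟩ else x
  have hγ : ∀ q ∈ O, (γ q : E) = g' q := fun q hq => by
    simp [γ, hBsub (hOB q hq)]
  have hγB : ∀ q ∈ O, γ q ∈ B' := fun q hq => by
    rw [hB', mem_preimage, hγ q hq]
    exact hOB q hq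
  have hγc : ContinuousOn γ O := by
    rw [IsInducing.subtypeVal.continuousOn_iff]
    exact (hg'.continuousOn.mono hOc).congr hγ
  have hγx : γ (f' x) = x := Subtype.ext (by
    rw [hγ _ (Metric.mem_ball_self hρ), hinv'.1 hxN'])
  have himage : ∀ U ∈ 𝓝 (f' x), U ⊆ O → γ '' U ∈ 𝓝[B'] x := by
    intro U hU hUO
    have h1 := hch'.image_mem_nhdsWithin hx hU
    rw [mem_nhdsWithin_iff_eventually] at h1 ⊢
    filter_upwards [continuous_subtype_val.continuousAt.eventually h1] with y hy hyB
    obtain ⟨q, ⟨-, hq⟩, hqy⟩ := hy hyB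
    exact ⟨q, hq, Subtype.ext ((hγ q (hUO hq)).trans hqy)⟩
  -- the chart of the ambient manifold
  obtain ⟨W, hW, hWsub⟩ : ∃ W ∈ 𝓝 x, W ∩ B' ⊆ γ '' O :=
    mem_nhdsWithin_iff_exists_mem_nhds_inter.1
      (himage O (Metric.ball_mem_nhds _ hρ) subset_rfl)
  -- The source lies in `W`, so every point of `B` in it is parametrized by `O`.
  obtain ⟨e, hxe, heW, hef⟩ := hch.exists_openPartialHomeomorph hint hW
  let φ : (Fin k → ℝ) → Fin (k + 1) → ℝ := fun q => f (g' q)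
  have heφ : ∀ q ∈ O, e (γ q) = φ q := fun q hq => by rw [hef, hγ q hq]
  have hφinj : InjOn φ O := by
    intro q hq q' hq' h
    have h1 : g' q = g' q' := hinv.1.injOn (hON q hq) (hON q' hq') h
    exact hinv'.2.injOn (hOc q hq) (hOc q' hq') h1
  obtain ⟨ι, _, S, α, hS, hfr, hcov, hα⟩ := hg'.exists_pieces_comp hf
  obtain ⟨T, hT, hTq⟩ := exists_isThin_two_sided_affine (E := Fin (k + 1) → ℝ) (φ := φ) hS hfr hOo
    (fun q hq => hcov q (hOc q hq) (hON q hq)) fun i q hq => hα i q hq.2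
  have hgood : ∀ q ∈ O \ T, γ q ∈ e.source → TwoSidedAt B' (γ q) := by
    rintro q ⟨hqO, hqT⟩ hqe
    obtain ⟨ℓ, i, j, hij⟩ := hTq q ⟨hqO, hqT⟩
    have hγq : ContinuousAt γ q := hγc.continuousAt (hOo.mem_nhds hqO)
    obtain ⟨s, t, ⟨w, hsw, htw⟩, hst⟩ := exists_local_min_eq_zero_iff
      (B := e.target ∩ e.symm ⁻¹' B') (by simp) hij (hOo.mem_nhds hqO) hφinj
      (by
        filter_upwards [hOo.mem_nhds hqO, hγq.eventually (e.open_source.eventually_mem hqe)]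
          with q' hq' hq'e
        rw [← heφ q' hq']
        refine ⟨e.map_source hq'e, ?_⟩
        rw [mem_preimage, e.left_inv hq'e]
        exact hγB q' hq')
      (by
        -- The parametrization has the continuous inverse `f'` on `B`, so points of `B` near `φ q`
        -- come from parameters near `q`.
        intro V hV
        have hf'c : ContinuousWithinAt (fun y => f' (e.symm y : M)) (e.target ∩ e.symm ⁻¹' B')
            (φ q) := by
          have h1 : ContinuousWithinAt f' N' (e.symm (φ q) : M) := by
            rw [← heφ q hqO, e.left_inv hqe, hγ q hqO]
            exact hf'.continuousOn _ (hgm' (hOc q hqO))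
          have h2 : ContinuousAt e.symm (φ q) :=
            e.continuousAt_symm (heφ q hqO ▸ e.map_source hqe)
          refine ContinuousWithinAt.comp (f := fun y => (e.symm y : E)) h1
            (continuous_subtype_val.continuousAt.comp h2).continuousWithinAt ?_
          rintro y ⟨hyt, hyB⟩
          obtain ⟨q', hq', hq'y⟩ := hWsub ⟨heW (e.map_target hyt), hyB⟩
          beta_reduce
          rw [← hq'y, hγ q' hq']
          exact hgm' (hOc q' hq')
        have hval : f' (e.symm (φ q) : M) = q := by
          rw [← heφ q hqO, e.left_inv hqe, hγ q hqO, hinv'.2 (hOc q hqO)]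
        have h3 : ∀ᶠ y in 𝓝[e.target ∩ e.symm ⁻¹' B'] (φ q), f' (e.symm y : M) ∈ V :=
          hf'c (by beta_reduce; rwa [hval])
        filter_upwards [eventually_nhdsWithin_iff.1 h3] with y hy hyB
        obtain ⟨q', hq', hq'y⟩ := hWsub ⟨heW (e.map_target hyB.1), hyB.2⟩
        refine ⟨q', ?_, ?_⟩
        · have := hy hyB
          rwa [← hq'y, hγ q' hq', hinv'.2 (hOc q' hq')] at this
        · rw [← heφ q' hq', hq'y, e.right_inv hyB.1])
    refine twoSidedAt_of_chart e hqe hsw htw ?_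
    rw [heφ q hqO]
    filter_upwards [hst, e.open_target.eventually_mem (heφ q hqO ▸ e.map_source hqe)] with y hy hyt
    rw [← hy]
    exact ⟨fun h => ⟨hyt, h⟩, fun h => h.2⟩
  have hbad : ∀ q ∈ O, γ q ∈ e.source → γ q ∈ badSet B' → q ∈ T := fun q hq hqe hqb => by
    by_contra h
    exact hqb.2 (hgood q ⟨hq, h⟩ hqe)
  -- a smaller parameter domain mapped into the chart
  obtain ⟨δ, hδ, hδball⟩ := Metric.mem_nhds_iff.1 (inter_mem (Metric.ball_mem_nhds (f' x) hρ)
    ((hγc.continuousAt (Metric.ball_mem_nhds _ hρ)).preimage_mem_nhds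
      (by rw [hγx]; exact e.open_source.mem_nhds hxe)))
  set O₂ : Set (Fin k → ℝ) := Metric.ball (f' x) δ
  have hO₂O : O₂ ⊆ O := fun q hq => (hδball hq).1
  have hO₂T : O₂ ∩ γ ⁻¹' badSet B' ⊆ T := fun q hq =>
    hbad q (hO₂O hq.1) (hδball hq.1).2 hq.2
  have hT₂ : IsThin 2 (O₂ ∩ γ ⁻¹' badSet B') := hT.mono hO₂T
  have hO₂x : f' x ∈ O₂ := Metric.mem_ball_self hδ
  refine ⟨e, hxe, ?_, ?_, γ '' O₂, himage O₂ (Metric.ball_mem_nhds _ hδ) hO₂O, ?_, ?_⟩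
  -- Each bad point is the image of a point of `T` under one of the finitely many affine pieces; the
  -- extra codimension is that of `B` in `M`.
  · refine IsThin.mono (isThin_biUnion (s := (univ : Set ι)) (T := fun i => α i '' T) (c := 2 + 1)
      finite_univ fun i _ => hT.image (α i) (by simp)) ?_
    rintro _ ⟨y, ⟨hye, hyb⟩, rfl⟩
    obtain ⟨q, hq, rfl⟩ := hWsub ⟨heW hye, hyb.1⟩
    obtain ⟨i, hi⟩ := mem_iUnion.1 (hcov q (hOc q hq) (hON q hq))
    refine mem_iUnion₂.2 ⟨i, mem_univ i, q, hbad q hq hye hyb, ?_⟩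
    rw [heφ q hq]
    exact (hα i q hi).symm
  · have h1 := Metric.isOpen_ball.subset_closure_diff_of_isThin (hT₂.of_le one_le_two) hO₂x
    have h2 := mem_closure_image (hγc.continuousAt (hOo.mem_nhds (hO₂O hO₂x))) h1
    rw [hγx] at h2
    refine closure_mono ?_ h2
    rintro _ ⟨q, ⟨hq, hq'⟩, rfl⟩
    exact ⟨hγB q (hO₂O hq), fun h => hq' ⟨hq, h⟩⟩
  · rintro _ ⟨q, hq, rfl⟩
    exact hγB q (hO₂O hq)
  · have heq : γ '' O₂ \ badSet B' = γ '' (O₂ \ (O₂ ∩ γ ⁻¹' badSet B')) := by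
      ext z
      constructor
      · rintro ⟨⟨q, hq, rfl⟩, hz⟩
        exact ⟨q, ⟨hq, fun h => hz h.2⟩, rfl⟩
      · rintro ⟨q, ⟨hq, hq'⟩, rfl⟩
        exact ⟨⟨q, hq, rfl⟩, fun h => hq' ⟨hq, h⟩⟩
    rw [heq]
    exact (hT₂.isPreconnected_diff Metric.isOpen_ball (convex_ball _ _)).image _
      (hγc.mono (sdiff_subset.trans hO₂O))

end PiecewiseLinear

/-! ### The separation theorem -/

theorem theorem4p5 (n m : ℕ) (hm : 1 ≤ m) (M B : Set (EuclideanSpace ℝ (Fin n)))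
    (hM : IsPLManifold m M) (hMsc : SimplyConnectedSpace M)
    (hB : IsClosedPLManifold (m - 1) B) (hBc : IsConnected B)
    (hBM : B ⊆ plInterior m M) :
    Nat.card (ConnectedComponents ↥(M \ B)) = 2 := by
  obtain ⟨k, rfl⟩ : ∃ k, m = k + 1 := ⟨m - 1, by omega⟩
  rw [Nat.add_sub_cancel] at hB
  have hBsub : B ⊆ M := fun y hy => (hBM hy).1
  have hlpc : LocallyPathConnectedSpace M := hM.locallyPathConnectedSpace
  have hcl : IsClosed (Subtype.val ⁻¹' B : Set M) :=
    hB.1.1.isCompact.isClosed.preimage continuous_subtype_val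
  have hconn : IsPreconnected (Subtype.val ⁻¹' B : Set M) := by
    rw [← IsInducing.subtypeVal.isPreconnected_image, Subtype.image_preimage_coe,
      inter_eq_right.2 hBsub]
    exact hBc.isPreconnected
  obtain ⟨b, hb⟩ := hBc.nonempty
  have hloc := fun (x : M) (hx : x ∈ (Subtype.val ⁻¹' B : Set M)) =>
    exists_chart_isThin_badSet hBM hB.2 hx
  have hG : (Subtype.val ⁻¹' B : Set M) ⊆
      closure (Subtype.val ⁻¹' B \ badSet (Subtype.val ⁻¹' B)) := fun x hx => by
    obtain ⟨-, -, -, h, -⟩ := hloc x hx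
    exact h
  refine card_connectedComponents_of_charts (E := Fin (k + 1) → ℝ) hcl ⟨⟨b, hBsub hb⟩, hb⟩
    (fun x hx => ?_) hG ?_ (j := inclusion sdiff_subset) (IsEmbedding.inclusion _) ?_
  · obtain ⟨e, hxe, hK, -⟩ := hloc x hx
    exact ⟨e, hxe, hK⟩
  -- The two-sided points are connected because `B` is, and the bad set has codimension two in the
  -- parameter balls of `B`.
  · refine hconn.of_dense_local sdiff_subset hG fun x hx => ?_
    obtain ⟨-, -, -, -, V, hV, hVB, hVp⟩ := hloc x hx
    refine ⟨V, hV, ?_⟩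
    rwa [← inter_sdiff_assoc, inter_eq_left.2 hVB]
  · rw [range_inclusion]
    ext y
    simp
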